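/- **Proposition (Euler–Lagrange equation).** Let $(\Omega,\mathcal B,\mu)$ be a probability space. For a strictly positive probability density $p$ let $L^{\Phi}(p\cdot\mu)$ be the Orlicz space of the Young function $\Phi$ with its Luxemburg norm, and put $$B_p=\Big\{u\in L^{\cosh-1}(\mu):\int u\,p\,d\mu=0\Big\},\qquad {}^*B_p=\Big\{v\in L^{\Psi}(p\cdot\mu):\int v\,p\,d\mu=0\Big\},\qquad \Psi(y)=(1+|y|)\log(1+|y|)-|y|,$$ $K_p(u)=\log\int e^{u}p\,d\mu$, and let $\mathcal S_p$ be the interior in $B_p$ of $\{u\in B_p: K_p(u)<\infty\}$. The maximal exponential model $\mathcal E(\mu)$ is the set of the densities $e^{u-K_1(u)}$ with $u\in\mathcal S_1$. For $p,q\in\mathcal E(\mu)$ let $s_p(q)=\log\frac qp-\int\log\frac qp\,p\,d\mu\in B_p$ be the exponential chart at $p$, with inverse $e_p(u)=e^{u-K_p(u)}\cdot p$, $u\in\mathcal S_p$; let ${}^e\mathbb U_p^q u=u-\int u\,q\,d\mu$ and ${}^m\mathbb U_p^q v=\frac pq v$ be the exponential and mixture transports $B_p\to B_q$, ${}^*B_p\to{}^*B_q$;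 and let $\langle\eta,w\rangle_q=\int\eta\,w\,q\,d\mu$ for $\eta\in{}^*B_q$, $w\in B_q$. Maps into $\mathcal E(\mu)$ are called smooth if their expressions in all charts $s_p$ are $C^\infty$. The velocity of a smooth curve $\gamma$ is $\overset{\star}{\gamma}(t)=\frac{d}{dh}s_{\gamma(t)}(\gamma(t+h))\big|_{h=0}\in B_{\gamma(t)}$. Let $L(q,w,t)\in\mathbb R$ be defined for $q\in\mathcal E(\mu)$, $w\in B_q$, $t\in[0,1]$, and be of class $C^1$ in charts: for every $p$ the function $L_p(u,v,t)=L\big(e_p(u),{}^e\mathbb U_p^{e_p(u)}v,t\big)$ is $C^1$ (in the Fréchet sense) on $\mathcal S_p\times B_p\times[0,1]$. Assume that $L$ has gradients $\operatorname{Grad}L(q,w,t)$, $\operatorname{Grad}_e L(q,w,t)\in{}^*B_q$, that is: - for all $p\in\mathcal E(\mu)$, $v\in B_p$, $t\in[0,1]$, the section $q\mapsto\operatorname{Grad}L(q,{}^e\mathbb U_p^qv,t)$ is the natural gradient of $F(q)=L(q,{}^e\mathbb U_p^qv,t)$: along every smooth curve $\gamma$ on an open set of times, $\frac{d}{ds}F(\gamma(s))=\big\langle\operatorname{Grad}L(\gamma(s),{}^e\mathbb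 U_p^{\gamma(s)}v,t),\overset{\star}{\gamma}(s)\big\rangle_{\gamma(s)}$; - $\operatorname{Grad}_e L$ is the fibre gradient: $\frac{d}{ds}L(q,w+sk,t)\big|_{s=0}=\langle\operatorname{Grad}_eL(q,w,t),k\rangle_q$ for all $w,k\in B_q$. Let $q\colon[0,1]\to\mathcal E(\mu)$ be a smooth curve that is an extremal of the action $\mathcal A(q)=\int_0^1L(q(t),\overset{\star}{q}(t),t)\,dt$: for every family $(q_\varepsilon)$ of curves on $[0,1]$ with $q_0=q$, $q_\varepsilon(0)=q(0)$, $q_\varepsilon(1)=q(1)$, and $(\varepsilon,t)\mapsto q_\varepsilon(t)$ smooth on $(-\delta,\delta)\times[0,1]$ for some $\delta>0$, one has $\frac{d}{d\varepsilon}\mathcal A(q_\varepsilon)\big|_{\varepsilon=0}=0$. Then for every $t\in[0,1]$ the mixture covariant derivative of $\eta(t)=\operatorname{Grad}_eL(q(t),\overset{\star}{q}(t),t)$ exists and $$\frac{D}{dt}\operatorname{Grad}_eL(q(t),\overset{\star}{q}(t),t)=\operatorname{Grad}L(q(t),\overset{\star}{q}(t),t),$$ where $\frac{D}{dt}\eta(t)={}^m\mathbb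 U_p^{q(t)}\,\frac{d}{dt}\,{}^m\mathbb U_{q(t)}^{p}\,\eta(t)$, the derivative being taken in the norm of ${}^*B_p$ (one-sided at $t=0,1$), for every reference density $p\in\mathcal E(\mu)$. -/

import Mathlib

open MeasureTheory Set Filter Topology
open scoped ENNReal ContDiff

noncomputable section

namespace StatBundle

/-! ### Young functions and Orlicz spaces -/

/-- Young functions, extended to the whole line by symmetry. -/
structure YoungFunction where
  toFun : ℝ → ℝ
  convexOn' : ConvexOn ℝ univ toFun
  continuous' : Continuous toFun
  even' : ∀ x, toFun (-x) = toFun x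
  map_zero' : toFun 0 = 0
  pos' : ∀ x, x ≠ 0 → 0 < toFun x

instance : CoeFun YoungFunction fun _ => ℝ → ℝ := ⟨YoungFunction.toFun⟩

namespace YoungFunction

variable (Φ : YoungFunction)

theorem nonneg (x : ℝ) : 0 ≤ Φ x := by
  rcases eq_or_ne x 0 with rfl | h
  · exact Φ.map_zero'.ge
  · exact (Φ.pos' x h).le

theorem convex_add {a b : ℝ} (ha : 0 ≤ a) (hb : 0 ≤ b) (hab : a + b = 1) (x y : ℝ) :
    Φ (a * x + b * y) ≤ a * Φ x + b * Φ y := by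
  simpa using Φ.convexOn'.2 (mem_univ x) (mem_univ y) ha hb hab

theorem map_mul_le {a : ℝ} (ha : 0 ≤ a) (ha1 : a ≤ 1) (x : ℝ) : Φ (a * x) ≤ a * Φ x := by
  have h := Φ.convex_add ha (sub_nonneg.2 ha1) (by ring) x 0
  simpa [Φ.map_zero'] using h

theorem map_abs (x : ℝ) : Φ |x| = Φ x := by
  rcases abs_choice x with h | h <;> rw [h]
  exact Φ.even' x

end YoungFunction

/-- The Young function `cosh x - 1`. -/
def coshTwo : YoungFunction where
  toFun x := Real.cosh x - 1
  convexOn' := by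
    have h1 : ConvexOn ℝ univ (fun x : ℝ => Real.exp (-x)) := by
      have := convexOn_exp.comp_linearMap (-LinearMap.id : ℝ →ₗ[ℝ] ℝ)
      simpa [Function.comp_def] using this
    have h := ((convexOn_exp.add h1).smul (c := (1 / 2 : ℝ)) (by norm_num)).add_const (-1)
    refine h.congr fun x _ => ?_
    simp [Real.cosh_eq]
    ring
  continuous' := by fun_prop
  even' x := by simp
  map_zero' := by simp
  pos' x hx := by simpa using hx

/-- The Young function conjugate to `exp x - 1 - x`, that is, `(1 + y) log (1 + y) - y` for
`y ≥ 0`, extended by symmetry. -/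
def expTwoStar : YoungFunction where
  toFun y := (1 + |y|) * Real.log (1 + |y|) - |y|
  convexOn' := by
    have h1 : ConvexOn ℝ (Ici 0) (fun x : ℝ => (1 + x) * Real.log (1 + x) - x) := by
      have h := (Real.convexOn_mul_log.translate_right 1)
      have h' : ConvexOn ℝ (Ici (0 : ℝ)) (fun x : ℝ => (1 + x) * Real.log (1 + x)) := by
        refine h.subset (fun x hx => ?_) (convex_Ici 0)
        simp only [mem_preimage, mem_Ici] at *
        linarith
      exact h'.sub (concaveOn_id (convex_Ici 0))
    have hmono : MonotoneOn (fun x : ℝ => (1 + x) * Real.log (1 + x) - x) (Ici 0) := by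
      intro x hx y hy hxy
      simp only [mem_Ici] at hx hy
      have e1 : 0 ≤ Real.log (1 + x) := Real.log_nonneg (by linarith)
      have e2 : 1 - (1 + x) / (1 + y) ≤ Real.log ((1 + y) / (1 + x)) := by
        have := Real.one_sub_inv_le_log_of_pos (x := (1 + y) / (1 + x)) (by positivity)
        simpa using this
      rw [Real.log_div (by positivity) (by positivity)] at e2
      have e3 : (1 + y) - (1 + x) ≤ (1 + y) * (Real.log (1 + y) - Real.log (1 + x)) := by
        have := mul_le_mul_of_nonneg_left e2 (show 0 ≤ 1 + y by positivity)
        rwa [mul_sub, mul_div_cancel₀ _ (by positivity), mul_one] at this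
      simp only
      nlinarith [mul_nonneg (sub_nonneg.2 hxy) e1]
    have himg : (fun x : ℝ => |x|) '' univ = Ici 0 := by
      ext y
      simp only [image_univ, mem_range, mem_Ici]
      exact ⟨fun ⟨x, hx⟩ => hx ▸ abs_nonneg x, fun h => ⟨y, abs_of_nonneg h⟩⟩
    have habs : ConvexOn ℝ univ (fun x : ℝ => |x|) := by
      have h := convexOn_univ_norm (E := ℝ)
      exact h
    exact ConvexOn.comp (himg ▸ h1) habs (himg ▸ hmono)
  continuous' := by
    refine Continuous.sub (Continuous.mul (by fun_prop) (Continuous.log (by fun_prop) ?_))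
      continuous_abs
    intro x
    positivity
  even' x := by simp
  map_zero' := by simp
  pos' x hx := by
    have h0 : 0 < |x| := abs_pos.2 hx
    have := Real.one_sub_inv_le_log_of_pos (x := 1 + |x|) (by positivity)
    have h2 : Real.log (1 + |x|)⁻¹ < (1 + |x|)⁻¹ - 1 := by
      apply Real.log_lt_sub_one_of_pos (by positivity)
      intro h
      rw [inv_eq_one] at h
      linarith
    rw [Real.log_inv] at h2
    have h3 := mul_lt_mul_of_pos_left h2 (show 0 < 1 + |x| by positivity)
    rw [mul_sub, mul_inv_cancel₀ (by positivity)] at h3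
    linarith

variable {Ω : Type*} [MeasurableSpace Ω] {μ : Measure Ω}

/-- Strictly positive probability densities with respect to `μ` (as `μ`-classes). -/
abbrev PosDensity (μ : Measure Ω) : Type _ :=
  {p : Ω →ₘ[μ] ℝ // (∀ᵐ x ∂μ, 0 < p x) ∧ ∫⁻ x, ENNReal.ofReal (p x) ∂μ = 1}

/-- The probability measure `p · μ`. -/
def PosDensity.toMeasure (p : PosDensity μ) : Measure Ω :=
  μ.withDensity fun x => ENNReal.ofReal (p.1 x)

namespace PosDensity

instance [IsProbabilityMeasure μ] : One (PosDensity μ) :=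
  ⟨⟨AEEqFun.const Ω 1, by
    filter_upwards [AEEqFun.coeFn_const Ω (μ := μ) (1 : ℝ)] with x hx
    simp [hx], by
    rw [lintegral_congr_ae (g := fun _ => 1)]
    · simp
    · filter_upwards [AEEqFun.coeFn_const Ω (μ := μ) (1 : ℝ)] with x hx
      simp [hx]⟩⟩

theorem measurable_ofReal (p : PosDensity μ) : Measurable fun x => ENNReal.ofReal (p.1 x) :=
  p.1.measurable.ennreal_ofReal

theorem toMeasure_ac (p : PosDensity μ) : p.toMeasure ≪ μ := withDensity_absolutelyContinuous _ _

theorem ac_toMeasure (p : PosDensity μ) : μ ≪ p.toMeasure := by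
  refine withDensity_absolutelyContinuous' p.measurable_ofReal.aemeasurable ?_
  filter_upwards [p.2.1] with x hx
  simpa using hx

instance (p : PosDensity μ) : IsProbabilityMeasure p.toMeasure :=
  ⟨by rw [toMeasure, withDensity_apply _ MeasurableSet.univ, Measure.restrict_univ, p.2.2]⟩

theorem lintegral_toMeasure (p : PosDensity μ) {f : Ω → ℝ≥0∞} (hf : Measurable f) :
    ∫⁻ x, f x ∂p.toMeasure = ∫⁻ x, ENNReal.ofReal (p.1 x) * f x ∂μ := by
  rw [toMeasure, lintegral_withDensity_eq_lintegral_mul _ p.measurable_ofReal hf]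
  rfl

theorem toMeasure_one [IsProbabilityMeasure μ] : (1 : PosDensity μ).toMeasure = μ := by
  have h : (fun x => ENNReal.ofReal ((1 : PosDensity μ).1 x)) =ᵐ[μ] 1 := by
    filter_upwards [AEEqFun.coeFn_const Ω (μ := μ) (1 : ℝ)] with x hx
    change ENNReal.ofReal ((AEEqFun.const Ω (1 : ℝ) : Ω →ₘ[μ] ℝ) x) = 1
    simp [hx]
  rw [toMeasure, withDensity_congr_ae h, withDensity_one]

end PosDensity

theorem integrable_toMeasure_iff (p : PosDensity μ) {f : Ω → ℝ} :
    Integrable f p.toMeasure ↔ Integrable (fun x => p.1 x * f x) μ := by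
  rw [PosDensity.toMeasure, integrable_withDensity_iff p.measurable_ofReal
    (Eventually.of_forall fun x => ENNReal.ofReal_lt_top)]
  refine integrable_congr ?_
  filter_upwards [p.2.1] with x h2
  rw [ENNReal.toReal_ofReal h2.le, mul_comm]

theorem integral_toMeasure (p : PosDensity μ) (f : Ω → ℝ) :
    ∫ x, f x ∂p.toMeasure = ∫ x, p.1 x * f x ∂μ := by
  rw [PosDensity.toMeasure, integral_withDensity_eq_integral_toReal_smul₀
    p.measurable_ofReal.aemeasurable (Eventually.of_forall fun x => ENNReal.ofReal_lt_top)]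
  refine integral_congr_ae ?_
  filter_upwards [p.2.1] with x h2
  rw [ENNReal.toReal_ofReal h2.le, smul_eq_mul]

/-- The modular `∫ Φ(f) p dμ`, with values in `[0, ∞]`. -/
def modular (Φ : YoungFunction) (p : PosDensity μ) (f : Ω → ℝ) : ℝ≥0∞ :=
  ∫⁻ x, ENNReal.ofReal (Φ (f x)) ∂p.toMeasure

section modular

variable {Φ : YoungFunction} {p : PosDensity μ}

theorem modular_congr {f g : Ω → ℝ} (h : f =ᵐ[μ] g) : modular Φ p f = modular Φ p g := by
  refine lintegral_congr_ae ?_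
  filter_upwards [p.toMeasure_ac.ae_le h] with x hx
  rw [hx]

theorem modular_add_le {f g : Ω → ℝ} (hf : Measurable f) {a b : ℝ}
    (ha : 0 < a) (hb : 0 < b) :
    modular Φ p (fun x => (a + b)⁻¹ * (f x + g x)) ≤
      ENNReal.ofReal (a / (a + b)) * modular Φ p (fun x => a⁻¹ * f x) +
        ENNReal.ofReal (b / (a + b)) * modular Φ p (fun x => b⁻¹ * g x) := by
  have hab : 0 < a + b := by positivity
  unfold modular
  rw [← lintegral_const_mul' _ _ ENNReal.ofReal_ne_top,
    ← lintegral_const_mul' _ _ ENNReal.ofReal_ne_top, ← lintegral_add_left]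
  · refine lintegral_mono fun x => ?_
    rw [← ENNReal.ofReal_mul (by positivity), ← ENNReal.ofReal_mul (by positivity),
      ← ENNReal.ofReal_add (mul_nonneg (by positivity) (Φ.nonneg _))
        (mul_nonneg (by positivity) (Φ.nonneg _))]
    refine ENNReal.ofReal_le_ofReal ?_
    have h := Φ.convex_add (a := a / (a + b)) (b := b / (a + b)) (by positivity) (by positivity)
      (by field_simp) (a⁻¹ * f x) (b⁻¹ * g x)
    convert h using 2
    field_simp
  · exact ((Φ.continuous'.measurable.comp (hf.const_mul _)).ennreal_ofReal).const_mul _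

theorem modular_mul_le {f : Ω → ℝ} {a : ℝ} (ha : 0 ≤ a) (ha1 : a ≤ 1) :
    modular Φ p (fun x => a * f x) ≤ ENNReal.ofReal a * modular Φ p f := by
  unfold modular
  rw [← lintegral_const_mul' _ _ ENNReal.ofReal_ne_top]
  refine lintegral_mono fun x => ?_
  rw [← ENNReal.ofReal_mul ha]
  exact ENNReal.ofReal_le_ofReal (Φ.map_mul_le ha ha1 _)

theorem modular_mono {f g : Ω → ℝ} (h : ∀ x, |f x| ≤ |g x|) : modular Φ p f ≤ modular Φ p g := by
  refine lintegral_mono fun x => ENNReal.ofReal_le_ofReal ?_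
  rw [← Φ.map_abs (f x), ← Φ.map_abs (g x)]
  rcases eq_or_lt_of_le (abs_nonneg (g x)) with h0 | h0
  · have : |f x| = 0 := le_antisymm ((h x).trans h0.ge) (abs_nonneg _)
    rw [this, ← h0]
  · have := Φ.map_mul_le (a := |f x| / |g x|) (by positivity) ((div_le_one h0).2 (h x)) |g x|
    rw [div_mul_cancel₀ _ h0.ne'] at this
    refine this.trans ?_
    exact mul_le_of_le_one_left (Φ.nonneg _) ((div_le_one h0).2 (h x))

end modular

/-- The Orlicz space `L^Φ(p · μ)`, as a vector subspace of `L⁰(μ)`. -/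
def orlicz (Φ : YoungFunction) (p : PosDensity μ) : Submodule ℝ (Ω →ₘ[μ] ℝ) where
  carrier := {f | ∃ ρ : ℝ, 0 < ρ ∧ modular Φ p (fun x => ρ⁻¹ * f x) < ⊤}
  zero_mem' := by
    refine ⟨1, one_pos, ?_⟩
    rw [modular_congr (g := fun _ => 0)]
    · simp [modular, Φ.map_zero']
    · filter_upwards [AEEqFun.coeFn_zero (α := Ω) (μ := μ) (β := ℝ)] with x hx
      simp [hx]
  add_mem' := by
    rintro f g ⟨a, ha, hfa⟩ ⟨b, hb, hgb⟩
    refine ⟨a + b, by positivity, ?_⟩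
    rw [modular_congr (g := fun x => (a + b)⁻¹ * (f x + g x))]
    · refine (modular_add_le f.measurable ha hb).trans_lt ?_
      exact ENNReal.add_lt_top.2 ⟨ENNReal.mul_lt_top ENNReal.ofReal_lt_top hfa,
        ENNReal.mul_lt_top ENNReal.ofReal_lt_top hgb⟩
    · filter_upwards [AEEqFun.coeFn_add f g] with x hx
      simp [hx]
  smul_mem' := by
    rintro c f ⟨a, ha, hfa⟩
    refine ⟨a * (|c| + 1), by positivity, lt_of_le_of_lt ?_ hfa⟩
    rw [modular_congr (g := fun x => (a * (|c| + 1))⁻¹ * (c * f x))]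
    · refine modular_mono fun x => ?_
      rw [abs_mul, abs_mul, abs_mul, ← mul_assoc]
      refine mul_le_mul_of_nonneg_right ?_ (abs_nonneg _)
      rw [abs_of_pos (by positivity : 0 < (a * (|c| + 1))⁻¹), abs_of_pos (inv_pos.2 ha)]
      rw [inv_mul_le_iff₀ (by positivity)]
      field_simp
      linarith
    · filter_upwards [AEEqFun.coeFn_smul c f] with x hx
      simp [hx]

/-- The Orlicz space `L^Φ(p · μ)` as a type, to be normed by the Luxemburg norm. -/
abbrev OrliczSpace (Φ : YoungFunction) (p : PosDensity μ) : Type _ := ↥(orlicz Φ p)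

/-- The Luxemburg norm. -/
instance (Φ : YoungFunction) (p : PosDensity μ) : Norm (OrliczSpace Φ p) :=
  ⟨fun f => sInf {ρ : ℝ | 0 < ρ ∧ modular Φ p (fun x => ρ⁻¹ * f.1 x) ≤ 1}⟩

section norm

variable {Φ : YoungFunction} {p : PosDensity μ}

theorem norm_def (f : OrliczSpace Φ p) :
    ‖f‖ = sInf {ρ : ℝ | 0 < ρ ∧ modular Φ p (fun x => ρ⁻¹ * f.1 x) ≤ 1} := rfl

theorem luxemburg_nonempty (f : OrliczSpace Φ p) :
    {ρ : ℝ | 0 < ρ ∧ modular Φ p (fun x => ρ⁻¹ * f.1 x) ≤ 1}.Nonempty := by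
  obtain ⟨ρ, hρ, h⟩ := f.2
  set M := (modular Φ p (fun x => ρ⁻¹ * f.1 x)).toReal with hM
  have hMe : modular Φ p (fun x => ρ⁻¹ * f.1 x) = ENNReal.ofReal M :=
    (ENNReal.ofReal_toReal h.ne).symm
  have hM0 : 0 ≤ M := ENNReal.toReal_nonneg
  refine ⟨ρ * (M + 1), by positivity, ?_⟩
  have := modular_mul_le (Φ := Φ) (p := p) (f := fun x => ρ⁻¹ * f.1 x) (a := (M + 1)⁻¹)
    (by positivity) (inv_le_one_of_one_le₀ (by linarith))
  rw [hMe, ← ENNReal.ofReal_mul (by positivity)] at this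
  have e : (fun x => (ρ * (M + 1))⁻¹ * f.1 x) = fun x => (M + 1)⁻¹ * (ρ⁻¹ * f.1 x) := by
    ext x
    rw [mul_inv]
    ring
  rw [e]
  refine this.trans ?_
  rw [← ENNReal.ofReal_one]
  refine ENNReal.ofReal_le_ofReal ?_
  rw [inv_mul_le_iff₀ (by positivity)]
  linarith

theorem luxemburg_bddBelow (f : OrliczSpace Φ p) :
    BddBelow {ρ : ℝ | 0 < ρ ∧ modular Φ p (fun x => ρ⁻¹ * f.1 x) ≤ 1} :=
  ⟨0, fun _ h => h.1.le⟩

theorem modular_le_one_of_norm_lt {f : OrliczSpace Φ p} {ρ : ℝ} (h : ‖f‖ < ρ) :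
    0 < ρ ∧ modular Φ p (fun x => ρ⁻¹ * f.1 x) ≤ 1 := by
  obtain ⟨a, ⟨ha, hfa⟩, har⟩ := exists_lt_of_csInf_lt (luxemburg_nonempty f) h
  have hρ : 0 < ρ := ha.trans har
  refine ⟨hρ, le_trans (modular_mono fun x => ?_) hfa⟩
  rw [abs_mul, abs_mul, abs_of_pos (inv_pos.2 hρ), abs_of_pos (inv_pos.2 ha)]
  gcongr

theorem norm_le_of_modular_le {f : OrliczSpace Φ p} {ρ : ℝ} (hρ : 0 < ρ)
    (h : modular Φ p (fun x => ρ⁻¹ * f.1 x) ≤ 1) : ‖f‖ ≤ ρ :=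
  csInf_le (luxemburg_bddBelow f) ⟨hρ, h⟩

theorem luxemburg_zero : ‖(0 : OrliczSpace Φ p)‖ = 0 := by
  refine le_antisymm (le_of_forall_pos_le_add fun ε hε => ?_)
    (Real.sInf_nonneg fun _ h => h.1.le)
  rw [zero_add]
  refine norm_le_of_modular_le hε ?_
  rw [modular_congr (g := fun _ => 0)]
  · simp [modular, Φ.map_zero']
  · filter_upwards [AEEqFun.coeFn_zero (α := Ω) (μ := μ) (β := ℝ)] with x hx
    simp [hx]

theorem orlicz_core (Φ : YoungFunction) (p : PosDensity μ) :
    NormedSpace.Core ℝ (OrliczSpace Φ p) where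
  norm_nonneg f := Real.sInf_nonneg fun _ h => h.1.le
  norm_smul := by
    have key : ∀ (c : ℝ) (f : OrliczSpace Φ p), c ≠ 0 → ‖c • f‖ ≤ ‖c‖ * ‖f‖ := by
      intro c f hc
      have hc' : 0 < |c| := abs_pos.2 hc
      rw [Real.norm_eq_abs, ← div_le_iff₀' hc']
      refine le_csInf (luxemburg_nonempty f) ?_
      rintro ρ ⟨hρ, h⟩
      rw [div_le_iff₀' hc']
      refine norm_le_of_modular_le (by positivity) ?_
      refine le_trans (le_of_eq_of_le (modular_congr
        (g := fun x => (|c| * ρ)⁻¹ * (c * f.1 x)) ?_) (modular_mono fun x => ?_)) h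
      · filter_upwards [AEEqFun.coeFn_smul c f.1] with x hx
        simp [hx]
      · rw [abs_mul, abs_mul, abs_mul, abs_of_pos (inv_pos.2 hρ),
          abs_of_pos (by positivity : 0 < (|c| * ρ)⁻¹)]
        apply le_of_eq
        field_simp
    intro c f
    rcases eq_or_ne c 0 with rfl | hc
    · rw [zero_smul, norm_zero, zero_mul, luxemburg_zero]
    · refine le_antisymm (key c f hc) ?_
      have := key c⁻¹ (c • f) (inv_ne_zero hc)
      rw [smul_smul, inv_mul_cancel₀ hc, one_smul, norm_inv] at this
      rwa [le_inv_mul_iff₀ (norm_pos_iff.2 hc)] at this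
  norm_triangle f g := by
    refine le_of_forall_pos_le_add fun ε hε => ?_
    obtain ⟨ha, hfa⟩ := modular_le_one_of_norm_lt (f := f) (ρ := ‖f‖ + ε / 2) (by linarith)
    obtain ⟨hb, hgb⟩ := modular_le_one_of_norm_lt (f := g) (ρ := ‖g‖ + ε / 2) (by linarith)
    set a := ‖f‖ + ε / 2 with ha'
    set b := ‖g‖ + ε / 2 with hb'
    have hab : ‖f‖ + ‖g‖ + ε = a + b := by rw [ha', hb']; ring
    rw [hab]
    refine norm_le_of_modular_le (by positivity) ?_
    rw [modular_congr (g := fun x => (a + b)⁻¹ * (f.1 x + g.1 x))]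
    · refine (modular_add_le f.1.measurable ha hb).trans ?_
      calc _ ≤ ENNReal.ofReal (a / (a + b)) * 1 + ENNReal.ofReal (b / (a + b)) * 1 := by gcongr
        _ = 1 := by
          rw [mul_one, mul_one, ← ENNReal.ofReal_add (by positivity) (by positivity)]
          rw [← add_div, div_self (by positivity), ENNReal.ofReal_one]
    · filter_upwards [AEEqFun.coeFn_add f.1 g.1] with x hx
      simp [hx]
  norm_eq_zero_iff f := by
    constructor
    · intro h
      have h1 : ∀ ρ : ℝ, 0 < ρ → ρ ≤ 1 → modular Φ p f.1 ≤ ENNReal.ofReal ρ := by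
        intro ρ hρ hρ1
        obtain ⟨-, h2⟩ := modular_le_one_of_norm_lt (f := f) (ρ := ρ) (by rwa [h])
        have h3 := modular_mul_le (Φ := Φ) (p := p) (f := fun x => ρ⁻¹ * f.1 x) hρ.le hρ1
        have e : (fun x => ρ * (ρ⁻¹ * f.1 x)) = fun x => f.1 x := by
          ext x
          field_simp
        rw [e] at h3
        calc modular Φ p f.1 ≤ ENNReal.ofReal ρ * 1 := h3.trans (by gcongr)
          _ = _ := mul_one _
      have h2 : modular Φ p f.1 = 0 := by
        refine le_antisymm (ENNReal.le_of_forall_pos_le_add fun ε hε _ => ?_) bot_le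
        rw [zero_add]
        refine (h1 (min ε 1) (lt_min (by exact_mod_cast hε) one_pos) (min_le_right _ _)).trans ?_
        refine (ENNReal.ofReal_le_ofReal (min_le_left _ _)).trans ?_
        simp
      have hm : Measurable fun x => ENNReal.ofReal (Φ (f.1 x)) :=
        (Φ.continuous'.measurable.comp f.1.measurable).ennreal_ofReal
      rw [modular, lintegral_eq_zero_iff hm] at h2
      have h3 : f.1 =ᵐ[μ] (0 : Ω →ₘ[μ] ℝ) := by
        filter_upwards [p.ac_toMeasure.ae_le h2,
          AEEqFun.coeFn_zero (α := Ω) (μ := μ) (β := ℝ)] with x hx h0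
        rw [h0]
        by_contra hne
        have := Φ.pos' (f.1 x) hne
        simp only [Pi.zero_apply, ENNReal.ofReal_eq_zero] at hx
        linarith
      exact Subtype.ext (AEEqFun.ext h3)
    · rintro rfl
      exact luxemburg_zero

instance (Φ : YoungFunction) (p : PosDensity μ) : NormedAddCommGroup (OrliczSpace Φ p) :=
  NormedAddCommGroup.ofCore (orlicz_core Φ p)

instance (Φ : YoungFunction) (p : PosDensity μ) : NormedSpace ℝ (OrliczSpace Φ p) :=
  NormedSpace.ofCore (orlicz_core Φ p)

end norm

/-! ### Centred random variables in an Orlicz space -/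

/-- The random variables in `L^Φ(r · μ)` that are integrable and centred for `p · μ`. -/
def centered (Φ : YoungFunction) (r p : PosDensity μ) : Submodule ℝ (OrliczSpace Φ r) where
  carrier := {u | Integrable u.1 p.toMeasure ∧ ∫ x, u.1 x ∂p.toMeasure = 0}
  zero_mem' := by
    have h : ((0 : OrliczSpace Φ r).1 : Ω → ℝ) =ᵐ[p.toMeasure] fun _ => 0 :=
      p.toMeasure_ac.ae_le (AEEqFun.coeFn_zero (α := Ω) (μ := μ) (β := ℝ))
    exact ⟨(integrable_zero _ _ _).congr h.symm, by rw [integral_congr_ae h, integral_zero]⟩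
  add_mem' := by
    rintro u v ⟨hu, hu0⟩ ⟨hv, hv0⟩
    have h : ((u + v).1 : Ω → ℝ) =ᵐ[p.toMeasure] fun x => u.1 x + v.1 x :=
      p.toMeasure_ac.ae_le (AEEqFun.coeFn_add u.1 v.1)
    exact ⟨(hu.add hv).congr h.symm, by
      rw [integral_congr_ae h, integral_add hu hv, hu0, hv0, add_zero]⟩
  smul_mem' := by
    rintro c u ⟨hu, hu0⟩
    have h : ((c • u).1 : Ω → ℝ) =ᵐ[p.toMeasure] fun x => c * u.1 x :=
      p.toMeasure_ac.ae_le (AEEqFun.coeFn_smul c u.1)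
    exact ⟨(hu.const_mul c).congr h.symm, by
      rw [integral_congr_ae h, integral_const_mul, hu0, mul_zero]⟩

/-- The normed space `{u ∈ L^Φ(r · μ) : ∫ u p dμ = 0}` with the Luxemburg norm of `L^Φ(r · μ)`
(a copy of the subspace `centered Φ r p`). -/
@[ext]
structure Fiber (Φ : YoungFunction) (r p : PosDensity μ) where
  vec : OrliczSpace Φ r
  mem : vec ∈ centered Φ r p

namespace Fiber

variable {Φ : YoungFunction} {r p : PosDensity μ}

def equiv (Φ : YoungFunction) (r p : PosDensity μ) : Fiber Φ r p ≃ ↥(centered Φ r p) where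
  toFun u := ⟨u.vec, u.mem⟩
  invFun u := ⟨u.1, u.2⟩

instance : AddCommGroup (Fiber Φ r p) := (equiv Φ r p).addCommGroup

instance : Module ℝ (Fiber Φ r p) := (equiv Φ r p).module ℝ

/-- The inclusion in the Orlicz space, as a linear map. -/
def vecₗ : Fiber Φ r p →ₗ[ℝ] OrliczSpace Φ r where
  toFun u := u.vec
  map_add' _ _ := rfl
  map_smul' _ _ := rfl

theorem vecₗ_injective : Function.Injective (vecₗ : Fiber Φ r p →ₗ[ℝ] OrliczSpace Φ r) :=
  fun _ _ h => Fiber.ext h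

instance : NormedAddCommGroup (Fiber Φ r p) :=
  NormedAddCommGroup.induced (Fiber Φ r p) (OrliczSpace Φ r) vecₗ vecₗ_injective

instance : NormedSpace ℝ (Fiber Φ r p) :=
  NormedSpace.induced ℝ (Fiber Φ r p) (OrliczSpace Φ r) vecₗ

theorem norm_vec (u : Fiber Φ r p) : ‖u.vec‖ = ‖u‖ := rfl

/-- The inclusion in the Orlicz space, as a continuous linear map. -/
def vecL : Fiber Φ r p →L[ℝ] OrliczSpace Φ r :=
  vecₗ.mkContinuous 1 fun u => by rw [one_mul]; rfl

theorem continuous_vec : Continuous fun u : Fiber Φ r p => u.vec := vecL.continuous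

/-- A continuous linear map with centred values, as a map to the fibre. -/
def lift {E : Type*} [NormedAddCommGroup E] [NormedSpace ℝ E] (f : E →L[ℝ] OrliczSpace Φ r)
    (hf : ∀ x, f x ∈ centered Φ r p) : E →L[ℝ] Fiber Φ r p :=
  LinearMap.mkContinuous
    { toFun := fun x => ⟨f x, hf x⟩
      map_add' := fun x y => Fiber.ext (map_add f x y)
      map_smul' := fun c x => Fiber.ext (map_smul f c x) } ‖f‖ fun x => f.le_opNorm x

end Fiber

/-! ### Exponential fibres and the maximal exponential model -/

variable [IsProbabilityMeasure μ]

/-- The space `L^{cosh - 1}(μ)` with the Luxemburg norm. -/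
abbrev ExpSpace (μ : Measure Ω) [IsProbabilityMeasure μ] : Type _ :=
  OrliczSpace coshTwo (1 : PosDensity μ)

/-- The exponential fibre `B_p = {u ∈ L^{cosh - 1}(μ) : ∫ u p dμ = 0}`. -/
abbrev ExpFiber (p : PosDensity μ) : Type _ := Fiber coshTwo (1 : PosDensity μ) p

/-- The proper domain of the moment functional `u ↦ ∫ eᵘ p dμ` on `B_p`. -/
def properDomain (p : PosDensity μ) : Set (ExpFiber p) :=
  {u | Integrable (fun x => Real.exp (u.1.1 x)) p.toMeasure}

theorem mem_properDomain_iff {p : PosDensity μ} {u : ExpFiber p} :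
    u ∈ properDomain p ↔ Integrable (fun x => Real.exp (u.1.1 x)) p.toMeasure := Iff.rfl

/-- The interior of the proper domain, in the Banach space `B_p`. -/
def chartDomain (p : PosDensity μ) : Set (ExpFiber p) := interior (properDomain p)

/-- The cumulant functional `K_p(u) = log ∫ eᵘ p dμ`. -/
def cumulant (p : PosDensity μ) (u : ExpFiber p) : ℝ :=
  Real.log (∫ x, Real.exp (u.1.1 x) ∂p.toMeasure)

/-- The densities of the form `exp (u - K_μ(u))` with `u` in the interior of the proper domain. -/
def IsMaxExp (q : PosDensity μ) : Prop :=
  ∃ u ∈ chartDomain (1 : PosDensity μ),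
    q.1 =ᵐ[μ] fun x => Real.exp (u.1.1 x - cumulant (1 : PosDensity μ) u)

/-- The maximal exponential model. -/
abbrev MaxExp (μ : Measure Ω) [IsProbabilityMeasure μ] : Type _ := {q : PosDensity μ // IsMaxExp q}

theorem lintegral_exp_abs_le {h : ExpSpace μ} (hh : ‖h‖ < 1) :
    ∫⁻ x, ENNReal.ofReal (Real.exp |h.1 x|) ∂μ ≤ 4 := by
  have h1 := (modular_le_one_of_norm_lt hh).2
  rw [modular, PosDensity.toMeasure_one] at h1
  have hm : Measurable fun x => ENNReal.ofReal (Real.cosh (h.1 x) - 1) :=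
    ((Real.continuous_cosh.measurable.comp h.1.measurable).sub_const 1).ennreal_ofReal
  calc ∫⁻ x, ENNReal.ofReal (Real.exp |h.1 x|) ∂μ
      ≤ ∫⁻ x, (2 * ENNReal.ofReal (Real.cosh (h.1 x) - 1) + 2) ∂μ := by
        refine lintegral_mono fun x => ?_
        have e : (2 : ℝ≥0∞) = ENNReal.ofReal 2 := by simp
        rw [e, ← ENNReal.ofReal_mul (by norm_num), ← ENNReal.ofReal_add
          (mul_nonneg (by norm_num) (sub_nonneg.2 (Real.one_le_cosh _))) (by norm_num)]
        refine ENNReal.ofReal_le_ofReal ?_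
        have := Real.exp_pos (-|h.1 x|)
        rw [← Real.cosh_abs, Real.cosh_eq]
        linarith
    _ = 2 * ∫⁻ x, ENNReal.ofReal (Real.cosh (h.1 x) - 1) ∂μ + 2 := by
        rw [lintegral_add_right _ measurable_const, lintegral_const_mul _ hm]
        simp
    _ ≤ 2 * 1 + 2 := by
        gcongr
        refine le_of_eq_of_le (lintegral_congr fun x => ?_) h1
        simp [coshTwo]
    _ = 4 := by norm_num

/-- Small perturbations of a point of the chart domain stay in the proper domain. -/
theorem exists_add_smul_mem {p : PosDensity μ} {u : ExpFiber p} (hu : u ∈ chartDomain p)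
    (h : ExpFiber p) : ∃ ε : ℝ, 0 < ε ∧ ε ≤ 1 ∧ u + ε • h ∈ properDomain p := by
  have hc : ContinuousAt (fun ε : ℝ => u + ε • h) 0 := by fun_prop
  have h1 : ∀ᶠ ε : ℝ in 𝓝 0, u + ε • h ∈ properDomain p := by
    refine hc.eventually (f := fun ε : ℝ => u + ε • h) ?_
    simpa using mem_interior_iff_mem_nhds.1 hu
  obtain ⟨δ, hδ, hb⟩ := Metric.eventually_nhds_iff.1 h1
  refine ⟨min (δ / 2) 1, lt_min (by positivity) one_pos, min_le_right _ _, hb ?_⟩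
  rw [Real.dist_eq, sub_zero, abs_of_pos (lt_min (by positivity) one_pos)]
  exact (min_le_left _ _).trans_lt (by linarith)

theorem exists_lintegral_abs_le (q : MaxExp μ) :
    ∃ C : ℝ≥0∞, C ≠ ⊤ ∧ ∀ h : ExpSpace μ, ‖h‖ < 1 →
      ∫⁻ x, ENNReal.ofReal |h.1 x| ∂q.1.toMeasure ≤ C := by
  obtain ⟨w, hw, hq⟩ := q.2
  obtain ⟨ε, hε, -, hwε⟩ := exists_add_smul_mem hw w
  set K := cumulant (1 : PosDensity μ) w
  set δ : ℝ := ε / (1 + ε) with hδ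
  have hδ0 : 0 < δ := by positivity
  have hδ1 : 0 ≤ 1 - δ := by
    rw [hδ, sub_nonneg, div_le_one (by positivity)]
    linarith
  have hint : Integrable (fun x => Real.exp ((1 + ε) * w.1.1 x)) μ := by
    have h1 : Integrable (fun x => Real.exp ((w + ε • w).1.1 x)) μ := by
      have := hwε
      rw [mem_properDomain_iff, PosDensity.toMeasure_one] at this
      exact this
    refine h1.congr ?_
    filter_upwards [AEEqFun.coeFn_add w.1.1 (ε • w.1.1), AEEqFun.coeFn_smul ε w.1.1] with x h2 h3
    have : (w + ε • w).1.1 x = w.1.1 x + ε * w.1.1 x := by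
      change (w.1.1 + ε • w.1.1) x = _
      rw [h2, Pi.add_apply, h3]
      rfl
    rw [this]
    ring_nf
  set M : ℝ≥0∞ := ∫⁻ x, ENNReal.ofReal (Real.exp ((1 + ε) * w.1.1 x)) ∂μ with hM
  have hMt : M ≠ ⊤ := by
    have := hint.lintegral_lt_top
    exact this.ne
  set c : ℝ := Real.exp (-K) * δ⁻¹ with hc
  refine ⟨ENNReal.ofReal c * (ENNReal.ofReal δ * 4 + ENNReal.ofReal (1 - δ) * M), ?_, ?_⟩
  · exact ENNReal.mul_ne_top ENNReal.ofReal_ne_top (ENNReal.add_ne_top.2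
      ⟨ENNReal.mul_ne_top ENNReal.ofReal_ne_top (by simp),
        ENNReal.mul_ne_top ENNReal.ofReal_ne_top hMt⟩)
  intro h hh
  rw [q.1.lintegral_toMeasure (by
    exact (continuous_abs.measurable.comp h.1.measurable).ennreal_ofReal)]
  calc ∫⁻ x, ENNReal.ofReal (q.1.1 x) * ENNReal.ofReal |h.1 x| ∂μ
      ≤ ∫⁻ x, ENNReal.ofReal c * (ENNReal.ofReal δ * ENNReal.ofReal (Real.exp |h.1 x|) +
          ENNReal.ofReal (1 - δ) * ENNReal.ofReal (Real.exp ((1 + ε) * w.1.1 x))) ∂μ := by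
        refine lintegral_mono_ae ?_
        filter_upwards [hq] with x hx
        rw [hx, ← ENNReal.ofReal_mul (Real.exp_pos _).le, ← ENNReal.ofReal_mul hδ0.le,
          ← ENNReal.ofReal_mul hδ1, ← ENNReal.ofReal_add (by positivity) (by positivity),
          ← ENNReal.ofReal_mul (by positivity)]
        refine ENNReal.ofReal_le_ofReal ?_
        have h1 : |h.1 x| ≤ δ⁻¹ * Real.exp (δ * |h.1 x|) := by
          rw [le_inv_mul_iff₀ hδ0]
          linarith [Real.add_one_le_exp (δ * |h.1 x|)]
        have h2 := convexOn_exp.2 (mem_univ |h.1 x|) (mem_univ ((1 + ε) * w.1.1 x)) hδ0.le hδ1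
          (by ring)
        simp only [smul_eq_mul] at h2
        have h3 : δ * |h.1 x| + (1 - δ) * ((1 + ε) * w.1.1 x) = δ * |h.1 x| + w.1.1 x := by
          rw [hδ]
          field_simp
          ring
        rw [h3] at h2
        calc Real.exp (w.1.1 x - K) * |h.1 x|
            ≤ Real.exp (w.1.1 x - K) * (δ⁻¹ * Real.exp (δ * |h.1 x|)) := by gcongr
          _ = c * Real.exp (δ * |h.1 x| + w.1.1 x) := by
              rw [hc, sub_eq_add_neg, Real.exp_add, Real.exp_add]
              ring
          _ ≤ _ := by gcongr
    _ = ENNReal.ofReal c * (ENNReal.ofReal δ * ∫⁻ x, ENNReal.ofReal (Real.exp |h.1 x|) ∂μ +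
          ENNReal.ofReal (1 - δ) * M) := by
        rw [lintegral_const_mul' _ _ ENNReal.ofReal_ne_top, lintegral_add_left,
          lintegral_const_mul' _ _ ENNReal.ofReal_ne_top,
          lintegral_const_mul' _ _ ENNReal.ofReal_ne_top]
        exact ((Real.continuous_exp.comp continuous_abs).measurable.comp
          h.1.measurable).ennreal_ofReal.const_mul _
    _ ≤ _ := by
        gcongr
        exact lintegral_exp_abs_le hh

theorem exists_expect_bound (q : MaxExp μ) :
    ∃ C : ℝ, ∀ h : ExpSpace μ, Integrable h.1 q.1.toMeasure ∧
      |∫ x, h.1 x ∂q.1.toMeasure| ≤ C * ‖h‖ := by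
  obtain ⟨C, hC, H⟩ := exists_lintegral_abs_le q
  have key : ∀ (h : ExpSpace μ) (ρ : ℝ), ‖h‖ < ρ → Integrable h.1 q.1.toMeasure ∧
      |∫ x, h.1 x ∂q.1.toMeasure| ≤ C.toReal * ρ := by
    intro h ρ hρ
    have hρ0 : 0 < ρ := (norm_nonneg h).trans_lt hρ
    have h1 : ‖ρ⁻¹ • h‖ < 1 := by
      rw [norm_smul, Real.norm_eq_abs, abs_of_pos (inv_pos.2 hρ0), inv_mul_lt_iff₀ hρ0]
      linarith
    have h2 := H _ h1
    have hae : ((ρ⁻¹ • h).1 : Ω → ℝ) =ᵐ[q.1.toMeasure] fun x => ρ⁻¹ * h.1 x :=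
      q.1.toMeasure_ac.ae_le (AEEqFun.coeFn_smul ρ⁻¹ h.1)
    have h3 : ∫⁻ x, ENNReal.ofReal |h.1 x| ∂q.1.toMeasure ≤ ENNReal.ofReal ρ * C := by
      calc _ = ENNReal.ofReal ρ * ∫⁻ x, ENNReal.ofReal |(ρ⁻¹ • h).1 x| ∂q.1.toMeasure := by
            rw [← lintegral_const_mul' _ _ ENNReal.ofReal_ne_top]
            refine lintegral_congr_ae ?_
            filter_upwards [hae] with x hx
            rw [hx, ← ENNReal.ofReal_mul hρ0.le, abs_mul, abs_of_pos (inv_pos.2 hρ0)]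
            congr 1
            field_simp
        _ ≤ _ := by gcongr
    have h4 : ∫⁻ x, ENNReal.ofReal |h.1 x| ∂q.1.toMeasure < ⊤ :=
      h3.trans_lt (ENNReal.mul_lt_top ENNReal.ofReal_lt_top hC.lt_top)
    have hint : Integrable h.1 q.1.toMeasure := by
      refine ⟨h.1.measurable.aestronglyMeasurable, ?_⟩
      rw [hasFiniteIntegral_iff_norm]
      exact h4
    refine ⟨hint, ?_⟩
    calc |∫ x, h.1 x ∂q.1.toMeasure| ≤ ∫ x, |h.1 x| ∂q.1.toMeasure := abs_integral_le_integral_abs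
      _ = (∫⁻ x, ENNReal.ofReal |h.1 x| ∂q.1.toMeasure).toReal := by
          rw [integral_eq_lintegral_of_nonneg_ae (Eventually.of_forall fun x => abs_nonneg _)
            hint.abs.aestronglyMeasurable]
      _ ≤ (ENNReal.ofReal ρ * C).toReal :=
          ENNReal.toReal_mono (ENNReal.mul_ne_top ENNReal.ofReal_ne_top hC) h3
      _ = C.toReal * ρ := by
          rw [ENNReal.toReal_mul, ENNReal.toReal_ofReal hρ0.le, mul_comm]
  refine ⟨C.toReal, fun h => ⟨(key h (‖h‖ + 1) (by linarith)).1, ?_⟩⟩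
  refine le_of_forall_pos_le_add fun ε hε => ?_
  have h1 := (key h (‖h‖ + ε / (C.toReal + 1)) (by
    have : 0 < ε / (C.toReal + 1) := by positivity
    linarith)).2
  refine h1.trans ?_
  rw [mul_add]
  gcongr
  rw [mul_div_assoc', div_le_iff₀ (by positivity)]
  nlinarith [ENNReal.toReal_nonneg (a := C)]

theorem integrable_of_mem (q : MaxExp μ) (h : ExpSpace μ) : Integrable h.1 q.1.toMeasure :=
  ((exists_expect_bound q).choose_spec h).1

/-- The expectation `u ↦ ∫ u q dμ` as a continuous linear functional on `L^{cosh - 1}(μ)`. -/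
def expect (q : MaxExp μ) : ExpSpace μ →L[ℝ] ℝ :=
  LinearMap.mkContinuousOfExistsBound
    { toFun := fun h => ∫ x, h.1 x ∂q.1.toMeasure
      map_add' := fun u v => by
        rw [← integral_add (integrable_of_mem q u) (integrable_of_mem q v)]
        exact integral_congr_ae (q.1.toMeasure_ac.ae_le (AEEqFun.coeFn_add u.1 v.1))
      map_smul' := fun c u => by
        rw [RingHom.id_apply, smul_eq_mul, ← integral_const_mul]
        exact integral_congr_ae (q.1.toMeasure_ac.ae_le (AEEqFun.coeFn_smul c u.1)) }
    ((exists_expect_bound q).imp fun _ hC h => (hC h).2)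

theorem expect_apply (q : MaxExp μ) (h : ExpSpace μ) :
    expect q h = ∫ x, h.1 x ∂q.1.toMeasure := rfl

/-- The constant random variable `1`. -/
def oneVec (μ : Measure Ω) [IsProbabilityMeasure μ] : ExpSpace μ :=
  ⟨AEEqFun.const Ω 1, by
    refine ⟨1, one_pos, ?_⟩
    rw [modular_congr (g := fun _ => 1)]
    · simp [modular]
    · filter_upwards [AEEqFun.coeFn_const Ω (μ := μ) (1 : ℝ)] with x hx
      simp [hx]⟩

theorem coe_sub_smul_oneVec (h : ExpSpace μ) (c : ℝ) :
    ((h - c • oneVec μ).1 : Ω → ℝ) =ᵐ[μ] fun x => h.1 x - c := by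
  filter_upwards [AEEqFun.coeFn_sub h.1 (c • (oneVec μ).1), AEEqFun.coeFn_smul c (oneVec μ).1,
    AEEqFun.coeFn_const Ω (μ := μ) (1 : ℝ)] with x h1 h2 h3
  change (h.1 - c • (oneVec μ).1) x = _
  rw [h1, Pi.sub_apply, h2]
  change _ - c * (AEEqFun.const Ω (1 : ℝ) : Ω →ₘ[μ] ℝ) x = _
  rw [h3]
  simp

theorem expect_oneVec (q : MaxExp μ) : expect q (oneVec μ) = 1 := by
  have h : ((oneVec μ).1 : Ω → ℝ) =ᵐ[q.1.toMeasure] fun _ => 1 :=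
    q.1.toMeasure_ac.ae_le (AEEqFun.coeFn_const Ω (μ := μ) (1 : ℝ))
  rw [expect_apply, integral_congr_ae h]
  simp

/-- The centring `u ↦ u - ∫ u q dμ`, from `L^{cosh - 1}(μ)` onto `B_q`. -/
def centering (q : MaxExp μ) : ExpSpace μ →L[ℝ] ExpFiber q.1 :=
  Fiber.lift (ContinuousLinearMap.id ℝ (ExpSpace μ) - (expect q).smulRight (oneVec μ)) fun h => by
    refine ⟨integrable_of_mem q _, ?_⟩
    change expect q (h - expect q h • oneVec μ) = 0
    rw [map_sub, map_smul, expect_oneVec, smul_eq_mul, mul_one, sub_self]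

theorem centering_coe (q : MaxExp μ) (h : ExpSpace μ) :
    (centering q h).1 = h - expect q h • oneVec μ := rfl

theorem centering_ae (q : MaxExp μ) (h : ExpSpace μ) :
    ((centering q h).1.1 : Ω → ℝ) =ᵐ[μ] fun x => h.1 x - expect q h :=
  coe_sub_smul_oneVec h _

theorem centering_self (q : MaxExp μ) (h : ExpFiber q.1) : centering q h.1 = h := by
  refine Fiber.ext ?_
  have : expect q h.1 = 0 := h.2.2
  rw [centering_coe, this, zero_smul, sub_zero]

theorem centering_oneVec (q : MaxExp μ) : centering q (oneVec μ) = 0 := by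
  refine Fiber.ext ?_
  rw [centering_coe, expect_oneVec, one_smul, sub_self]
  rfl

/-- The exponential transport `u ↦ u - ∫ u q dμ` from `B_p` to `B_q`. -/
def eTransport (p q : MaxExp μ) : ExpFiber p.1 →L[ℝ] ExpFiber q.1 :=
  (centering q).comp Fiber.vecL

/-! ### Charts of the maximal exponential model -/

theorem integral_exp_pos {p : PosDensity μ} {u : ExpFiber p} (hu : u ∈ properDomain p) :
    0 < ∫ x, Real.exp (u.1.1 x) ∂p.toMeasure :=
  MeasureTheory.integral_exp_pos hu

theorem exp_cumulant {p : PosDensity μ} {u : ExpFiber p} (hu : u ∈ properDomain p) :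
    Real.exp (cumulant p u) = ∫ x, Real.exp (u.1.1 x) ∂p.toMeasure :=
  Real.exp_log (integral_exp_pos hu)

/-- The density `exp (u - K_p(u)) · p`, for `u` in the proper domain. -/
def expDensity (p : PosDensity μ) (u : ExpFiber p) (hu : u ∈ properDomain p) : PosDensity μ :=
  ⟨AEEqFun.mk (fun x => Real.exp (u.1.1 x - cumulant p u) * p.1 x)
      ((Real.continuous_exp.measurable.comp (u.1.1.measurable.sub_const _)).mul
        p.1.measurable).aestronglyMeasurable, by
    constructor
    · filter_upwards [AEEqFun.coeFn_mk (μ := μ)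
        (fun x => Real.exp (u.1.1 x - cumulant p u) * p.1 x) _, p.2.1] with x h1 h2
      rw [h1]
      positivity
    · have hm : Measurable fun x => ENNReal.ofReal (Real.exp (u.1.1 x - cumulant p u)) :=
        (Real.continuous_exp.measurable.comp (u.1.1.measurable.sub_const _)).ennreal_ofReal
      have h1 : ∫⁻ x, ENNReal.ofReal (Real.exp (u.1.1 x - cumulant p u)) ∂p.toMeasure = 1 := by
        have h2 : Integrable (fun x => Real.exp (u.1.1 x - cumulant p u)) p.toMeasure := by
          simp_rw [Real.exp_sub]
          exact Integrable.div_const hu _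
        rw [← ofReal_integral_eq_lintegral_ofReal h2
          (Eventually.of_forall fun x => (Real.exp_pos _).le)]
        simp_rw [Real.exp_sub]
        rw [integral_div, exp_cumulant hu, div_self (integral_exp_pos hu).ne', ENNReal.ofReal_one]
      rw [p.lintegral_toMeasure hm] at h1
      refine Eq.trans (lintegral_congr_ae ?_) h1
      filter_upwards [AEEqFun.coeFn_mk (μ := μ)
        (fun x => Real.exp (u.1.1 x - cumulant p u) * p.1 x) _] with x h3
      rw [h3, mul_comm, ENNReal.ofReal_mul' (Real.exp_pos _).le]⟩

theorem expDensity_ae (p : PosDensity μ) (u : ExpFiber p) (hu : u ∈ properDomain p) :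
    (expDensity p u hu).1 =ᵐ[μ] fun x => Real.exp (u.1.1 x - cumulant p u) * p.1 x :=
  AEEqFun.coeFn_mk _ _

theorem isMaxExp_one : IsMaxExp (1 : PosDensity μ) := by
  have hc : cumulant (1 : PosDensity μ) 0 = 0 := by
    have h : ∀ᵐ x ∂(1 : PosDensity μ).toMeasure, Real.exp ((0 : Ω →ₘ[μ] ℝ) x) = 1 := by
      filter_upwards [(1 : PosDensity μ).toMeasure_ac.ae_le
        (AEEqFun.coeFn_zero (α := Ω) (μ := μ) (β := ℝ))] with x hx
      rw [hx]
      simp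
    change Real.log (∫ x, Real.exp ((0 : Ω →ₘ[μ] ℝ) x) ∂(1 : PosDensity μ).toMeasure) = 0
    rw [integral_congr_ae h]
    simp
  refine ⟨0, ?_, ?_⟩
  · refine mem_interior.2 ⟨Metric.ball 0 1, fun u hu => ?_, Metric.isOpen_ball, by simp⟩
    have hu1 : ‖u.1‖ < 1 := by
      rw [Fiber.norm_vec]
      exact mem_ball_zero_iff.1 hu
    have h := lintegral_exp_abs_le hu1
    rw [mem_properDomain_iff, PosDensity.toMeasure_one]
    refine ⟨(Real.continuous_exp.measurable.comp u.1.1.measurable).aestronglyMeasurable, ?_⟩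
    rw [hasFiniteIntegral_iff_ofReal (Eventually.of_forall fun x => (Real.exp_pos _).le)]
    refine lt_of_le_of_lt (lintegral_mono fun x => ?_) (h.trans_lt (by simp))
    exact ENNReal.ofReal_le_ofReal (Real.exp_le_exp.2 (le_abs_self _))
  · filter_upwards [AEEqFun.coeFn_const Ω (μ := μ) (1 : ℝ),
      AEEqFun.coeFn_zero (α := Ω) (μ := μ) (β := ℝ)] with x h1 h2
    change (AEEqFun.const Ω (1 : ℝ) : Ω →ₘ[μ] ℝ) x = Real.exp ((0 : Ω →ₘ[μ] ℝ) x - _)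
    rw [h1, h2, hc]
    simp

/-- The reference density `1`. -/
def maxExpOne (μ : Measure Ω) [IsProbabilityMeasure μ] : MaxExp μ := ⟨1, isMaxExp_one⟩

theorem coe_add_ae (u v : ExpSpace μ) : ((u + v).1 : Ω → ℝ) =ᵐ[μ] fun x => u.1 x + v.1 x :=
  AEEqFun.coeFn_add u.1 v.1

theorem coe_sub_ae (u v : ExpSpace μ) : ((u - v).1 : Ω → ℝ) =ᵐ[μ] fun x => u.1 x - v.1 x :=
  AEEqFun.coeFn_sub u.1 v.1

theorem coe_smul_ae (c : ℝ) (u : ExpSpace μ) : ((c • u).1 : Ω → ℝ) =ᵐ[μ] fun x => c * u.1 x :=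
  AEEqFun.coeFn_smul c u.1

theorem maxExpOne_toMeasure : (maxExpOne μ).1.toMeasure = μ := PosDensity.toMeasure_one

theorem isMaxExp_iff (q : PosDensity μ) : IsMaxExp q ↔ ∃ u ∈ chartDomain (maxExpOne μ).1,
    q.1 =ᵐ[μ] fun x => Real.exp (u.1.1 x - cumulant (maxExpOne μ).1 u) := Iff.rfl

/-- Change of chart: the coordinate in `B_o` of the tilted density. -/
theorem centering_add_mem (o p : MaxExp μ) (w : ExpFiber o.1) (K : ℝ)
    (hp : p.1.1 =ᵐ[μ] fun x => Real.exp (w.1.1 x - K) * o.1.1 x)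
    (u : ExpFiber p.1) (hu : u ∈ chartDomain p.1) :
    centering o (u.1 + w.1) ∈ chartDomain o.1 := by
  have hT : Continuous fun x : ExpFiber o.1 => centering p (x.1 - w.1) := by exact (centering p).continuous.comp (Fiber.continuous_vec.sub continuous_const)
  have hTu : centering p ((centering o (u.1 + w.1)).1 - w.1) = u := by
    have h1 : (centering o (u.1 + w.1)).1 - w.1 = u.1 - expect o (u.1 + w.1) • oneVec μ := by
      rw [centering_coe]
      abel
    rw [h1, map_sub, map_smul, centering_oneVec, smul_zero, sub_zero, centering_self]
  have hdom : ∀ x : ExpFiber o.1, centering p (x.1 - w.1) ∈ properDomain p.1 →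
      x ∈ properDomain o.1 := by
    intro x hx
    have h1 := (integrable_toMeasure_iff p.1).1 hx
    rw [mem_properDomain_iff, integrable_toMeasure_iff]
    refine (h1.const_mul (Real.exp (K + expect p (x.1 - w.1)))).congr ?_
    filter_upwards [centering_ae p (x.1 - w.1), coe_sub_ae x.1 w.1, hp] with y h2 h3 h4
    rw [h2, h3, h4, mul_comm (Real.exp (w.1.1 y - K)), mul_assoc, ← Real.exp_add, mul_left_comm,
      ← Real.exp_add]
    congr 2
    ring
  refine mem_interior.2 ⟨(fun x : ExpFiber o.1 => centering p (x.1 - w.1)) ⁻¹' chartDomain p.1,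
    fun x hx => hdom x (interior_subset (s := properDomain p.1) hx),
    isOpen_interior.preimage hT, ?_⟩
  rw [mem_preimage, hTu]
  exact hu

theorem cumulant_center_add (o p : MaxExp μ) (w : ExpFiber o.1) (K : ℝ)
    (hp : p.1.1 =ᵐ[μ] fun x => Real.exp (w.1.1 x - K) * o.1.1 x)
    (u : ExpFiber p.1) (hu : u ∈ chartDomain p.1) :
    cumulant o.1 (centering o (u.1 + w.1)) = cumulant p.1 u + K - expect o (u.1 + w.1) := by
  apply Real.exp_injective
  rw [exp_cumulant (interior_subset (centering_add_mem o p w K hp u hu)), sub_eq_add_neg,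
    Real.exp_add, Real.exp_add, exp_cumulant (interior_subset hu), integral_toMeasure,
    integral_toMeasure, mul_assoc, ← integral_mul_const]
  refine integral_congr_ae ?_
  filter_upwards [centering_ae o (u.1 + w.1), coe_add_ae u.1 w.1, hp] with x h1 h2 h3
  rw [h1, h2, h3, ← Real.exp_add, mul_comm (Real.exp (w.1.1 x - K)), mul_assoc, mul_assoc,
    ← Real.exp_add, ← Real.exp_add]
  congr 2
  ring

theorem expDensity_center_add (o p : MaxExp μ) (w : ExpFiber o.1) (K : ℝ)
    (hp : p.1.1 =ᵐ[μ] fun x => Real.exp (w.1.1 x - K) * o.1.1 x)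
    (u : ExpFiber p.1) (hu : u ∈ chartDomain p.1) :
    (expDensity p.1 u (interior_subset hu)).1 =ᵐ[μ] fun x =>
      Real.exp ((centering o (u.1 + w.1)).1.1 x - cumulant o.1 (centering o (u.1 + w.1))) *
        o.1.1 x := by
  rw [cumulant_center_add o p w K hp u hu]
  filter_upwards [expDensity_ae p.1 u (interior_subset hu), hp, centering_ae o (u.1 + w.1),
    coe_add_ae u.1 w.1] with x h1 h2 h3 h4
  rw [h1, h2, h3, h4, ← mul_assoc, ← Real.exp_add]
  congr 2
  ring

theorem maxExpOne_ae : (maxExpOne μ).1.1 =ᵐ[μ] fun _ => 1 :=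
  AEEqFun.coeFn_const Ω (μ := μ) (1 : ℝ)

/-- The maximal exponential model is closed under exponential tilting. -/
theorem isMaxExp_expDensity (p : MaxExp μ) (u : ExpFiber p.1) (hu : u ∈ chartDomain p.1) :
    IsMaxExp (expDensity p.1 u (interior_subset hu)) := by
  obtain ⟨w, -, hp⟩ := (isMaxExp_iff p.1).1 p.2
  have hp' : p.1.1 =ᵐ[μ] fun x =>
      Real.exp (w.1.1 x - cumulant (maxExpOne μ).1 w) * (maxExpOne μ).1.1 x := by
    filter_upwards [hp, maxExpOne_ae] with x h1 h2
    rw [h1, h2, mul_one]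
  refine (isMaxExp_iff _).2 ⟨_, centering_add_mem _ p w _ hp' u hu, ?_⟩
  filter_upwards [expDensity_center_add _ p w _ hp' u hu, maxExpOne_ae] with x h1 h2
  rw [h1, h2, mul_one]

open Classical in
/-- The inverse chart `e_p(u) = exp (u - K_p(u)) · p`, defined for `u` in the chart domain
(extended by the junk value `p` outside of it). -/
def expMap (p : MaxExp μ) (u : ExpFiber p.1) : MaxExp μ :=
  if hu : u ∈ chartDomain p.1 then
    ⟨expDensity p.1 u (interior_subset hu), isMaxExp_expDensity p u hu⟩
  else p

theorem log_ratio_mem (p q : MaxExp μ) : ∃ h : ExpSpace μ,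
    h.1 =ᵐ[μ] fun x => Real.log (q.1.1 x / p.1.1 x) := by
  obtain ⟨u, -, hp⟩ := p.2
  obtain ⟨v, -, hq⟩ := q.2
  refine ⟨v.1 - u.1 - (cumulant 1 v - cumulant 1 u) • oneVec μ, ?_⟩
  filter_upwards [hp, hq, coe_sub_smul_oneVec (v.1 - u.1) (cumulant 1 v - cumulant 1 u),
    coe_sub_ae v.1 u.1] with x h1 h2 h3 h4
  rw [h1, h2, h3, h4, ← Real.exp_sub, Real.log_exp]
  ring

/-- The random variable `log (q / p)`, as an element of `L^{cosh - 1}(μ)`. -/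
def logRatio (p q : MaxExp μ) : ExpSpace μ :=
  ⟨AEEqFun.mk (fun x => Real.log (q.1.1 x / p.1.1 x))
    (Real.measurable_log.comp (q.1.1.measurable.div p.1.1.measurable)).aestronglyMeasurable, by
    obtain ⟨h, hh⟩ := log_ratio_mem p q
    have e : h.1 = AEEqFun.mk (fun x => Real.log (q.1.1 x / p.1.1 x)) (Real.measurable_log.comp
        (q.1.1.measurable.div p.1.1.measurable)).aestronglyMeasurable :=
      AEEqFun.ext (hh.trans (AEEqFun.coeFn_mk _ _).symm)
    rw [← e]
    exact h.2⟩

/-- The exponential chart `s_p(q) = log (q / p) - ∫ log (q / p) p dμ`. -/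
def chart (p q : MaxExp μ) : ExpFiber p.1 := centering p (logRatio p q)

/-! ### Mixture fibres -/

/-- The mixture fibre `{v ∈ L^{(exp_2)^*}(p · μ) : ∫ v p dμ = 0}`, where
`exp_2(x) = exp x - 1 - x`. -/
abbrev MixFiber (p : PosDensity μ) : Type _ := Fiber expTwoStar p p

/-- Young's inequality for the conjugate pair `exp x - 1 - x`, `(1 + y) log (1 + y) - y`. -/
theorem young_exp {x y : ℝ} (hy : 0 ≤ y) : x * y ≤ Real.exp x - 1 - x + expTwoStar y := by
  have h := Real.add_one_le_exp (x - Real.log (1 + y))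
  rw [Real.exp_sub, Real.exp_log (by positivity), le_div_iff₀ (by positivity)] at h
  simp only [expTwoStar, abs_of_nonneg hy]
  nlinarith

/-- The pointwise bound behind the mixture transport. -/
theorem expTwoStar_mul_le {r y l : ℝ} (hr : 0 ≤ r) (hy : 0 ≤ y) (hl : 0 < l) (hl1 : l ≤ 1) :
    expTwoStar (r * y) ≤ r * ((2 + l⁻¹) * expTwoStar y + 1 + l⁻¹ * (1 + r ^ l)) := by
  have hlog : ∀ z : ℝ, 0 ≤ z → Real.log (1 + z) ≤ z := fun z hz => by
    have := Real.log_le_sub_one_of_pos (x := 1 + z) (by positivity)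
    linarith
  have h1 : expTwoStar (r * y) ≤ r * y * Real.log (1 + r * y) := by
    simp only [expTwoStar, abs_of_nonneg (mul_nonneg hr hy)]
    nlinarith [hlog (r * y) (mul_nonneg hr hy)]
  have h2 : Real.log (1 + r * y) ≤ Real.log (1 + r) + Real.log (1 + y) := by
    rw [← Real.log_mul (by positivity) (by positivity)]
    exact Real.log_le_log (by positivity) (by nlinarith)
  have h3 : y ≤ expTwoStar y + 1 := by
    have := young_exp (x := 1) hy
    linarith [Real.exp_one_lt_d9]
  have h4 : y * Real.log (1 + y) ≤ 2 * expTwoStar y + 1 := by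
    have e : expTwoStar y = (1 + y) * Real.log (1 + y) - y := by
      simp only [expTwoStar, abs_of_nonneg hy]
    nlinarith [Real.log_nonneg (show (1 : ℝ) ≤ 1 + y by linarith)]
  have h5 : y * Real.log (1 + r) ≤ l⁻¹ * (1 + r ^ l + expTwoStar y) := by
    have h6 := young_exp (x := l * Real.log (1 + r)) hy
    have h7 : Real.exp (l * Real.log (1 + r)) ≤ 1 + r ^ l := by
      rw [mul_comm, ← Real.rpow_def_of_pos (by positivity)]
      have := Real.rpow_add_le_add_rpow zero_le_one hr hl.le hl1
      simpa using this
    have h8 : 0 ≤ l * Real.log (1 + r) :=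
      mul_nonneg hl.le (Real.log_nonneg (by linarith))
    rw [le_inv_mul_iff₀ hl]
    nlinarith
  have h9 := mul_le_mul_of_nonneg_left h2 (mul_nonneg hr hy)
  have h10 := mul_le_mul_of_nonneg_left (add_le_add h4 h5) hr
  calc expTwoStar (r * y) ≤ r * y * (Real.log (1 + r) + Real.log (1 + y)) := h1.trans h9
    _ = r * (y * Real.log (1 + y) + y * Real.log (1 + r)) := by ring
    _ ≤ _ := h10
    _ = _ := by ring

theorem exists_integrable_ratio_rpow (p q : MaxExp μ) : ∃ l : ℝ, 0 < l ∧ l ≤ 1 ∧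
    ∫⁻ x, ENNReal.ofReal (p.1.1 x * (p.1.1 x / q.1.1 x) ^ l) ∂μ < ⊤ := by
  obtain ⟨u, hu, hp⟩ := p.2
  obtain ⟨v, -, hq⟩ := q.2
  obtain ⟨l, hl, hl1, hmem⟩ := exists_add_smul_mem hu (u - v)
  refine ⟨l, hl, hl1, ?_⟩
  rw [mem_properDomain_iff, PosDensity.toMeasure_one] at hmem
  set K := cumulant 1 u with hK
  set K' := cumulant 1 v with hK'
  refine lt_of_eq_of_lt (lintegral_congr_ae ?_)
    (hmem.const_mul (Real.exp (-K + l * (K' - K)))).lintegral_lt_top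
  filter_upwards [hp, hq, coe_add_ae u.1 (l • (u.1 - v.1)), coe_smul_ae l (u.1 - v.1),
    coe_sub_ae u.1 v.1] with x h1 h2 h3 h4 h5
  have h6 : (u + l • (u - v)).1.1 x = u.1.1 x + l * (u.1.1 x - v.1.1 x) := by
    change (u.1 + l • (u.1 - v.1)).1 x = _
    rw [h3, h4, h5]
  rw [h1, h2, h6, ← Real.exp_sub, ← Real.exp_mul, ← Real.exp_add, ← Real.exp_add]
  congr 2
  ring

theorem mixTransport_mem (p q : MaxExp μ) (v : OrliczSpace expTwoStar p.1) :
    AEEqFun.mk (fun x => p.1.1 x / q.1.1 x * v.1 x)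
      ((p.1.1.measurable.div q.1.1.measurable).mul v.1.measurable).aestronglyMeasurable ∈
      orlicz expTwoStar q.1 := by
  obtain ⟨ρ, hρ, hv⟩ := v.2
  obtain ⟨l, hl, hl1, hpq⟩ := exists_integrable_ratio_rpow p q
  refine ⟨ρ, hρ, ?_⟩
  have hm : Measurable fun x => ENNReal.ofReal (expTwoStar (ρ⁻¹ * v.1 x)) :=
    (expTwoStar.continuous'.measurable.comp (v.1.measurable.const_mul _)).ennreal_ofReal
  rw [modular_congr (g := fun x => p.1.1 x / q.1.1 x * (ρ⁻¹ * v.1 x))]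
  · rw [modular, p.1.lintegral_toMeasure hm] at hv
    rw [modular, q.1.lintegral_toMeasure (by
      exact (expTwoStar.continuous'.measurable.comp ((p.1.1.measurable.div
        q.1.1.measurable).mul (v.1.measurable.const_mul _))).ennreal_ofReal)]
    have hp1 : ∫⁻ x, ENNReal.ofReal (p.1.1 x) ∂μ < ⊤ := by
      rw [p.1.2.2]
      simp
    calc _ ≤ ∫⁻ x, (ENNReal.ofReal (2 + l⁻¹) * (ENNReal.ofReal (p.1.1 x) *
            ENNReal.ofReal (expTwoStar (ρ⁻¹ * v.1 x))) +
          (ENNReal.ofReal (1 + l⁻¹) * ENNReal.ofReal (p.1.1 x) +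
            ENNReal.ofReal l⁻¹ *
              ENNReal.ofReal (p.1.1 x * (p.1.1 x / q.1.1 x) ^ l))) ∂μ := by
          refine lintegral_mono_ae ?_
          filter_upwards [p.1.2.1, q.1.2.1] with x h1 h2
          have h3 : 0 ≤ expTwoStar (ρ⁻¹ * v.1 x) := expTwoStar.nonneg _
          rw [← ENNReal.ofReal_mul h2.le, ← ENNReal.ofReal_mul h1.le,
            ← ENNReal.ofReal_mul (by positivity), ← ENNReal.ofReal_mul (by positivity),
            ← ENNReal.ofReal_mul (by positivity), ← ENNReal.ofReal_add (by positivity)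
              (by positivity), ← ENNReal.ofReal_add (by positivity) (by positivity)]
          refine ENNReal.ofReal_le_ofReal ?_
          have h4 := expTwoStar_mul_le (r := p.1.1 x / q.1.1 x) (y := |ρ⁻¹ * v.1 x|)
            (by positivity) (abs_nonneg _) hl hl1
          rw [expTwoStar.map_abs, ← abs_of_pos (div_pos h1 h2), ← abs_mul, expTwoStar.map_abs,
            abs_of_pos (div_pos h1 h2)] at h4
          refine (mul_le_mul_of_nonneg_left h4 h2.le).trans (le_of_eq ?_)
          rw [← mul_assoc, mul_div_cancel₀ _ h2.ne']
          ring
      _ < ⊤ := by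
          have hm1 : Measurable fun x => ENNReal.ofReal (2 + l⁻¹) * (ENNReal.ofReal (p.1.1 x) *
            ENNReal.ofReal (expTwoStar (ρ⁻¹ * v.1 x))) :=
            (p.1.measurable_ofReal.mul hm).const_mul _
          rw [lintegral_add_left hm1, lintegral_add_left (p.1.measurable_ofReal.const_mul _),
            lintegral_const_mul' _ _ ENNReal.ofReal_ne_top,
            lintegral_const_mul' _ _ ENNReal.ofReal_ne_top,
            lintegral_const_mul' _ _ ENNReal.ofReal_ne_top]
          exact ENNReal.add_lt_top.2 ⟨ENNReal.mul_lt_top ENNReal.ofReal_lt_top hv,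
            ENNReal.add_lt_top.2 ⟨ENNReal.mul_lt_top ENNReal.ofReal_lt_top hp1,
              ENNReal.mul_lt_top ENNReal.ofReal_lt_top hpq⟩⟩
  · filter_upwards [AEEqFun.coeFn_mk (μ := μ) (fun x => p.1.1 x / q.1.1 x * v.1 x) _] with x hx
    rw [hx]
    ring

/-- The mixture transport `v ↦ (p / q) v` from the mixture fibre at `p` to the one at `q`. -/
def mTransport (p q : MaxExp μ) (v : MixFiber p.1) : MixFiber q.1 :=
  ⟨⟨AEEqFun.mk (fun x => p.1.1 x / q.1.1 x * v.1.1 x) _, mixTransport_mem p q v.1⟩, by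
    have h : AEEqFun.mk (μ := μ) (fun x => p.1.1 x / q.1.1 x * v.1.1 x) ((p.1.1.measurable.div
        q.1.1.measurable).mul v.1.1.measurable).aestronglyMeasurable =ᵐ[q.1.toMeasure]
        fun x => p.1.1 x / q.1.1 x * v.1.1 x :=
      q.1.toMeasure_ac.ae_le (AEEqFun.coeFn_mk _ _)
    obtain ⟨h1, h2⟩ := v.2
    constructor
    · refine Integrable.congr ?_ h.symm
      rw [integrable_toMeasure_iff] at h1 ⊢
      refine h1.congr ?_
      filter_upwards [q.1.2.1] with x h4
      field_simp
    · refine (integral_congr_ae h).trans (Eq.trans ?_ h2)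
      rw [integral_toMeasure, integral_toMeasure]
      refine integral_congr_ae ?_
      filter_upwards [q.1.2.1] with x h4
      field_simp⟩

/-- The duality pairing `⟨η, w⟩_q = ∫ η w q dμ` of the mixture and the exponential fibre. -/
def pairing (q : PosDensity μ) (η : MixFiber q) (w : ExpFiber q) : ℝ :=
  ∫ x, η.1.1 x * w.1.1 x ∂q.toMeasure

/-! ### Curves, covariant derivatives, gradients, Lagrangians -/

/-- A map into the maximal exponential model is smooth on `s` if its expressions in all
exponential charts are smooth on `s`. -/
def SmoothOn {E : Type*} [NormedAddCommGroup E] [NormedSpace ℝ E] (γ : E → MaxExp μ)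
    (s : Set E) : Prop :=
  ∀ p : MaxExp μ, ContDiffOn ℝ ((⊤ : ℕ∞) : WithTop ℕ∞) (fun x => chart p (γ x)) s

/-- The velocity at time `t` of a curve defined on `I`: the time derivative of its expression in
the exponential chart centred at its current position. -/
def velocity (I : Set ℝ) (γ : ℝ → MaxExp μ) (t : ℝ) : ExpFiber (γ t).1 :=
  derivWithin (fun s => chart (γ t) (γ s)) I t

/-- `ζ` is the mixture covariant derivative at `t ∈ I` of the field `η` along the curve `q`:
`ζ = ᵐU_p^{q(t)} (d/dt) ᵐU_{q(t)}^p η(t)`, where `ᵐU` is the mixture transport and the derivative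
is taken in the Banach space given by the mixture fibre at `p`, whatever the reference `p`. -/
def HasMixCovDerivWithinAt (q : ℝ → MaxExp μ) (η : (t : ℝ) → MixFiber (q t).1) (I : Set ℝ)
    (t : ℝ) (ζ : MixFiber (q t).1) : Prop :=
  ∀ p : MaxExp μ, ∃ d : MixFiber p.1,
    HasDerivWithinAt (fun s => mTransport (q s) p (η s)) d I t ∧ mTransport p (q t) d = ζ

/-- The section `G` of the mixture bundle is the (natural) gradient of the scalar field `F`. -/
def IsNaturalGradient (F : MaxExp μ → ℝ) (G : (q : MaxExp μ) → MixFiber q.1) : Prop :=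
  ∀ (I : Set ℝ) (γ : ℝ → MaxExp μ), IsOpen I → SmoothOn γ I → ∀ t ∈ I,
    HasDerivAt (fun s => F (γ s)) (pairing (γ t).1 (G (γ t)) (velocity I γ t)) t

/-- Real functions `L(q, w, t)` on the exponential statistical bundle times the time axis; only
the values at times `t ∈ [0, 1]` matter. -/
abbrev Lagrangian (μ : Measure Ω) [IsProbabilityMeasure μ] : Type _ :=
  (q : MaxExp μ) → ExpFiber q.1 → ℝ → ℝ

/-- Fields `(q, w, t) ↦ G(q, w, t)` with values in the mixture fibre at `q`. -/
abbrev MixField (μ : Measure Ω) [IsProbabilityMeasure μ] : Type _ :=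
  (q : MaxExp μ) → ExpFiber q.1 → ℝ → MixFiber q.1

namespace Lagrangian

/-- The expression `L_p(u, v, t) = L(e_p(u), ᵉU_p^{e_p(u)} v, t)` in the chart centred at `p`. -/
def inChart (L : Lagrangian μ) (p : MaxExp μ) (x : ExpFiber p.1 × ExpFiber p.1 × ℝ) : ℝ :=
  L (expMap p x.1) (eTransport p (expMap p x.1) x.2.1) x.2.2

/-- Continuous (Fréchet) differentiability in all charts. -/
def IsC1 (L : Lagrangian μ) : Prop :=
  ∀ p : MaxExp μ, ContDiffOn ℝ 1 (L.inChart p) (chartDomain p.1 ×ˢ univ ×ˢ Icc (0 : ℝ) 1)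

/-- `G = Grad L`: for all `p`, `v` and `t`, the section `q ↦ G(q, ᵉU_p^q v, t)` is the natural
gradient of the scalar field `q ↦ L(q, ᵉU_p^q v, t)`. -/
def HasGrad (L : Lagrangian μ) (G : MixField μ) : Prop :=
  ∀ (p : MaxExp μ) (v : ExpFiber p.1), ∀ t ∈ Icc (0 : ℝ) 1,
    IsNaturalGradient (fun q => L q (eTransport p q v) t) (fun q => G q (eTransport p q v) t)

/-- `G = Grad_e L`: for all `q` and `t`, `G(q, w, t)` is the gradient of the partial map
`w ↦ L(q, w, t)` in the duality of the mixture and the exponential fibre at `q`. -/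
def HasFiberGrad (L : Lagrangian μ) (G : MixField μ) : Prop :=
  ∀ (q : MaxExp μ) (w k : ExpFiber q.1), ∀ t ∈ Icc (0 : ℝ) 1,
    HasDerivAt (fun s : ℝ => L q (w + s • k) t) (pairing q.1 (G q w t) k) 0

/-- The action integral of a curve on `[0, 1]`. -/
def action (L : Lagrangian μ) (q : ℝ → MaxExp μ) : ℝ :=
  ∫ t in (0 : ℝ)..1, L (q t) (velocity (Icc 0 1) q t) t

end Lagrangian

/-- Smooth variations of the curve `q` on `[0, 1]` with fixed endpoints. -/
structure IsVariation (q : ℝ → MaxExp μ) (Γ : ℝ → ℝ → MaxExp μ) : Prop where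
  base : ∀ t ∈ Icc (0 : ℝ) 1, Γ 0 t = q t
  left : ∀ ε, Γ ε 0 = q 0
  right : ∀ ε, Γ ε 1 = q 1
  smooth : ∃ δ : ℝ, 0 < δ ∧
    SmoothOn (fun x : ℝ × ℝ => Γ x.1 x.2) (Ioo (-δ) δ ×ˢ Icc (0 : ℝ) 1)

/-- The curve `q` is an extremal of the action of `L`: the action is stationary at `q` along every
smooth variation with fixed endpoints. -/
def Lagrangian.IsExtremal (L : Lagrangian μ) (q : ℝ → MaxExp μ) : Prop :=
  ∀ Γ : ℝ → ℝ → MaxExp μ, IsVariation q Γ → HasDerivAt (fun ε => L.action (Γ ε)) 0 0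

end StatBundle

end

/-!
Fix a reference density `p`. In the exponential chart at `p` the extremal `q` becomes a smooth curve
`u` in an open subset of the normed space `B_p`, and `L` becomes the `C¹` function `L.inChart p`.
Changes of charts are affine, with the exponential transport as linear part
(`chart_eq_eTransport_add`), so the velocity of `q` is the transport of `u'` (`velocity_eq`), the
curves `u + ε φ h` define smooth variations of `q` for all `h ∈ B_p` and all test functions `φ`
vanishing at `0` and `1`, and the first variation of the action is the classical one. Thus the partial derivatives
`a(t), b(t) ∈ B_p*` of `L.inChart p` in the base and the fibre direction, along `(u, u', t)`,
satisfy `∫ (φ a + φ' b) h = 0`. As `a` and `b` are continuous for the dual norm, the lemma of du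
Bois-Reymond gives `b' = a` in the norm of `B_p*` (`hasDerivWithinAt_of_forall_integral_eq_zero`).

The mixture transport is dual to the exponential one (`pairing_eTransport`), so `a(t)` and `b(t)`
are the pairings with the mixture transports to `p` of `Grad L` and `Grad_e L`. It remains to replace
the dual norm by the Luxemburg norm of the mixture fibre at `p`. This is possible because the pairing
embeds this fibre topologically in `B_p*` (`exists_norm_le_of_pairing_le`): the Young function of the
mixture fibre is conjugate to `exp x - 1 - x`, and an exponential moment under `p · μ` bounds the norm
of `L^{cosh - 1}(μ)`, since some negative power of `p` is `μ`-integrable.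
-/

namespace StatBundle

/-! ### Calculus of variations in a normed space -/

section CalculusOfVariations

/-- The lemma of du Bois-Reymond. -/
theorem sub_eq_integral_of_forall_integral_eq_zero {α β : ℝ → ℝ}
    (hα : ContinuousOn α (Icc 0 1)) (hβ : ContinuousOn β (Icc 0 1))
    (H : ∀ φ : ℝ → ℝ, ContDiff ℝ ∞ φ → φ 0 = 0 → φ 1 = 0 →
      ∫ t in (0 : ℝ)..1, (φ t * α t + deriv φ t * β t) = 0)
    {s t : ℝ} (hs : s ∈ Icc (0 : ℝ) 1) (ht : t ∈ Icc (0 : ℝ) 1) :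
    β t - β s = ∫ r in s..t, α r := by
  have h01 : uIcc (0 : ℝ) 1 = Icc 0 1 := uIcc_of_le zero_le_one
  -- a continuous extension of `α`, so that its primitive is differentiable everywhere
  set α' : ℝ → ℝ := IccExtend zero_le_one ((Icc (0 : ℝ) 1).domRestrict α) with hα'
  have hα'c : Continuous α' := (continuousOn_iff_continuous_domRestrict.1 hα).Icc_extend'
  have hαα' : ∀ r ∈ Icc (0 : ℝ) 1, α' r = α r := fun r hr => IccExtend_of_mem _ _ hr
  set A : ℝ → ℝ := fun x => ∫ r in (0 : ℝ)..x, α' r with hA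
  have hAd : ∀ x, HasDerivAt A (α' x) x := fun x => (hα'c.integral_hasStrictDerivAt 0 x).hasDerivAt
  have hAc : Continuous A := continuous_iff_continuousAt.2 fun x => (hAd x).continuousAt
  have hint : ∀ {f : ℝ → ℝ}, ContinuousOn f (Icc 0 1) → IntervalIntegrable f volume 0 1 :=
    fun hf => (h01.symm ▸ hf).intervalIntegrable
  set m : ℝ := ∫ r in (0 : ℝ)..1, (β r - A r) with hm
  have hfc : ContinuousOn (fun r => β r - A r - m) (Icc 0 1) :=
    (hβ.sub hAc.continuousOn).sub continuousOn_const
  have hzero : ∀ᵐ r, r ∈ Ioo (0 : ℝ) 1 → β r - A r - m = 0 := by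
    refine isOpen_Ioo.ae_eq_zero_of_integral_contDiff_smul_eq_zero
      ((hfc.mono Ioo_subset_Icc_self).locallyIntegrableOn measurableSet_Ioo)
      fun g hg _ hgs => ?_
    have hgc : Continuous g := hg.continuous
    set c : ℝ := ∫ r in (0 : ℝ)..1, g r with hc
    -- the primitive of `g - c` vanishes at both endpoints, so `H` applies to it
    set φ : ℝ → ℝ := fun x => (∫ r in (0 : ℝ)..x, g r) - c * x with hφ
    have hφd : ∀ x, HasDerivAt φ (g x - c) x := fun x => by
      have := (hgc.integral_hasStrictDerivAt 0 x).hasDerivAt.sub ((hasDerivAt_id x).const_mul c)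
      rwa [mul_one] at this
    have hφ' : deriv φ = fun x => g x - c := funext fun x => (hφd x).deriv
    have hφs : ContDiff ℝ ∞ φ := by
      refine contDiff_infty_iff_deriv.2 ⟨fun x => (hφd x).differentiableAt, ?_⟩
      rw [hφ']
      exact hg.sub contDiff_const
    have hφ0 : φ 0 = 0 := by simp [hφ]
    have hφ1 : φ 1 = 0 := by simp [hφ, hc]
    have h1 := H φ hφs hφ0 hφ1
    have h2 : ∫ r in (0 : ℝ)..1, ((g r - c) * A r + φ r * α' r) = φ 1 * A 1 - φ 0 * A 0 :=
      intervalIntegral.integral_deriv_mul_eq_sub (fun x _ => hφd x) (fun x _ => hAd x)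
        ((hgc.sub continuous_const).intervalIntegrable _ _) (hα'c.intervalIntegrable _ _)
    rw [hφ0, hφ1, zero_mul, zero_mul, sub_zero] at h2
    have i3 : IntervalIntegrable (fun r => φ r * α r + deriv φ r * β r) volume 0 1 := by
      rw [hφ']
      exact hint ((hφs.continuous.continuousOn.mul hα).add
        ((hgc.sub continuous_const).continuousOn.mul hβ))
    have i4 : IntervalIntegrable (fun r => (g r - c) * A r + φ r * α' r) volume 0 1 :=
      (((hgc.sub continuous_const).mul hAc).add (hφs.continuous.mul hα'c)).intervalIntegrable _ _
    have h3 : ∫ r in (0 : ℝ)..1, (g r - c) * (β r - A r) = 0 := by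
      have h := intervalIntegral.integral_sub i3 i4
      rw [h1, h2, sub_zero] at h
      refine Eq.trans (intervalIntegral.integral_congr fun r hr => ?_) h
      rw [h01] at hr
      simp only [hφ']
      rw [hαα' r hr]
      ring
    have h4 : ∫ r, g r • (β r - A r - m) = ∫ r in (0 : ℝ)..1, g r • (β r - A r - m) := by
      refine (intervalIntegral.integral_eq_integral_of_support_subset ?_).symm
      intro r hr
      refine Ioo_subset_Ioc_self (hgs (subset_tsupport g ?_))
      exact left_ne_zero_of_smul (show g r • (β r - A r - m) ≠ 0 from hr)
    have h5 : ∀ r, g r • (β r - A r - m) = (g r - c) * (β r - A r) + c * (β r - A r) - m * g r :=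
      fun r => by
        rw [smul_eq_mul]
        ring
    have hβA : ContinuousOn (fun r => β r - A r) (Icc 0 1) := hβ.sub hAc.continuousOn
    have i1 : IntervalIntegrable (fun r => (g r - c) * (β r - A r)) volume 0 1 :=
      hint ((hgc.sub continuous_const).continuousOn.mul hβA)
    have i2 : IntervalIntegrable (fun r => c * (β r - A r)) volume 0 1 :=
      hint (continuousOn_const.mul hβA)
    have i5 : IntervalIntegrable (fun r => m * g r) volume 0 1 :=
      hint (continuous_const.mul hgc).continuousOn
    rw [h4]
    simp_rw [h5]
    rw [intervalIntegral.integral_sub (i1.add i2) i5,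
      intervalIntegral.integral_add i1 i2, h3, intervalIntegral.integral_const_mul,
      intervalIntegral.integral_const_mul]
    ring
  have heq : EqOn (fun r => β r - A r - m) (fun _ => 0) (Icc 0 1) := by
    refine Measure.eqOn_Icc_of_ae_eq (μ := volume) zero_ne_one ?_ hfc continuousOn_const
    rw [← restrict_Ioo_eq_restrict_Icc]
    exact (ae_restrict_iff' measurableSet_Ioo).2 hzero
  have e1 := heq hs
  have e2 := heq ht
  simp only at e1 e2
  have e3 : ∫ r in s..t, α r = A t - A s := by
    rw [hA, intervalIntegral.integral_interval_sub_left (hα'c.intervalIntegrable _ _)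
      (hα'c.intervalIntegrable _ _)]
    exact intervalIntegral.integral_congr fun r hr =>
      (hαα' r (uIcc_subset_Icc hs ht hr)).symm
  rw [e3]
  linarith

variable {E : Type*} [NormedAddCommGroup E] [NormedSpace ℝ E]

/-- The weak form of the Euler–Lagrange equation implies the strong one, in the norm of the dual
space. -/
theorem hasDerivWithinAt_of_forall_integral_eq_zero {a b : ℝ → E →L[ℝ] ℝ}
    (ha : ContinuousOn a (Icc 0 1)) (hb : ContinuousOn b (Icc 0 1))
    (H : ∀ (h : E) (φ : ℝ → ℝ), ContDiff ℝ ∞ φ → φ 0 = 0 → φ 1 = 0 →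
      ∫ t in (0 : ℝ)..1, (φ t * a t h + deriv φ t * b t h) = 0)
    {t : ℝ} (ht : t ∈ Icc (0 : ℝ) 1) : HasDerivWithinAt b (a t) (Icc 0 1) t := by
  rw [hasDerivWithinAt_iff_isLittleO, Asymptotics.isLittleO_iff]
  intro ε hε
  obtain ⟨δ, hδ, hat⟩ := Metric.continuousWithinAt_iff.1 (ha t ht) ε hε
  filter_upwards [self_mem_nhdsWithin, mem_nhdsWithin_of_mem_nhds (Metric.ball_mem_nhds t hδ)]
    with s hs hsδ
  refine ContinuousLinearMap.opNorm_le_bound _ (by positivity) fun h => ?_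
  have hah : ContinuousOn (fun r => a r h) (Icc 0 1) := ha.clm_apply continuousOn_const
  have hbh : ContinuousOn (fun r => b r h) (Icc 0 1) := hb.clm_apply continuousOn_const
  have h1 := sub_eq_integral_of_forall_integral_eq_zero hah hbh (H h) ht hs
  have h2 : (b s - b t - (s - t) • a t) h = ∫ r in t..s, (a r h - a t h) := by
    rw [intervalIntegral.integral_sub
      ((hah.mono (uIcc_subset_Icc ht hs)).intervalIntegrable) intervalIntegrable_const, ← h1,
      intervalIntegral.integral_const]
    rfl
  rw [h2]
  have h3 : ‖∫ r in t..s, (a r h - a t h)‖ ≤ ε * ‖h‖ * |s - t| := by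
    refine intervalIntegral.norm_integral_le_of_norm_le_const fun r hr => ?_
    have hr' := uIoc_subset_uIcc hr
    have h4 : ‖a r - a t‖ ≤ ε := by
      rw [← dist_eq_norm]
      refine (hat (uIcc_subset_Icc ht hs hr') ?_).le
      rw [Metric.mem_ball] at hsδ
      exact lt_of_le_of_lt (by
        rw [Real.dist_eq, Real.dist_eq]
        exact abs_sub_left_of_mem_uIcc hr') hsδ
    rw [← sub_apply]
    exact (ContinuousLinearMap.le_opNorm _ _).trans (by gcongr)
  refine h3.trans (le_of_eq ?_)
  rw [Real.norm_eq_abs]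
  ring

/-- Small variations of a curve in an open set stay in this set. -/
theorem exists_forall_add_smul_mem {S : Set E} (hS : IsOpen S) {u : ℝ → E}
    (hu : ContinuousOn u (Icc 0 1)) (huS : ∀ t ∈ Icc (0 : ℝ) 1, u t ∈ S) {φ : ℝ → ℝ}
    (hφ : Continuous φ) (h : E) : ∃ δ : ℝ, 0 < δ ∧ ∀ ε ∈ Ioo (-δ) δ, ∀ t ∈ Icc (0 : ℝ) 1,
      u t + (ε * φ t) • h ∈ S := by
  obtain ⟨ρ, hρ, hsub⟩ := (isCompact_Icc.image_of_continuousOn hu).exists_thickening_subset_open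
    hS (image_subset_iff.2 huS)
  obtain ⟨B, hB⟩ := (isCompact_Icc (a := (0 : ℝ)) (b := 1)).exists_bound_of_continuousOn
    (hφ.smul continuous_const : Continuous fun t => φ t • h).continuousOn
  refine ⟨ρ / (|B| + 1), by positivity, fun ε hε t ht => hsub ?_⟩
  refine Metric.mem_thickening_iff.2 ⟨u t, mem_image_of_mem u ht, ?_⟩
  rw [dist_eq_norm, add_sub_cancel_left, mul_smul, norm_smul, Real.norm_eq_abs]
  have h1 : ‖φ t • h‖ ≤ |B| := (hB t ht).trans (le_abs_self B)
  have h2 : |ε| < ρ / (|B| + 1) := abs_lt.2 hε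
  rw [lt_div_iff₀ (by positivity)] at h2
  nlinarith [abs_nonneg ε, abs_nonneg B]

/-- The first variation of an action integral in a normed space. -/
theorem hasDerivAt_integral_variation {S : Set E} (hS : IsOpen S) {ℓ : E × E × ℝ → ℝ}
    (hℓ : ContDiffOn ℝ 1 ℓ (S ×ˢ univ ×ˢ Icc (0 : ℝ) 1)) {u v : ℝ → E}
    (hu : ContinuousOn u (Icc 0 1)) (hv : ContinuousOn v (Icc 0 1))
    (huS : ∀ t ∈ Icc (0 : ℝ) 1, u t ∈ S) {φ ψ : ℝ → ℝ} (hφ : Continuous φ) (hψ : Continuous ψ)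
    (h : E) :
    HasDerivAt (fun ε : ℝ => ∫ t in (0 : ℝ)..1, ℓ (u t + (ε * φ t) • h, v t + (ε * ψ t) • h, t))
      (∫ t in (0 : ℝ)..1, fderivWithin ℝ ℓ (S ×ˢ univ ×ˢ Icc (0 : ℝ) 1) (u t, v t, t)
        (φ t • h, ψ t • h, 0)) 0 := by
  set T : Set (E × E × ℝ) := S ×ˢ univ ×ˢ Icc (0 : ℝ) 1 with hT
  have hTu : UniqueDiffOn ℝ T :=
    hS.uniqueDiffOn.prod (uniqueDiffOn_univ.prod (uniqueDiffOn_Icc zero_lt_one))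
  obtain ⟨δ', hδ', hmem'⟩ := exists_forall_add_smul_mem hS hu huS hφ h
  -- a closed interval of parameters, for compactness
  set δ := δ' / 2 with hδ_def
  have hδ : 0 < δ := by positivity
  set X : ℝ → ℝ → E × E × ℝ := fun ε t => (u t + (ε * φ t) • h, v t + (ε * ψ t) • h, t) with hX
  have hXT : ∀ ε ∈ Icc (-δ) δ, ∀ t ∈ Icc (0 : ℝ) 1, X ε t ∈ T := fun ε hε t ht =>
    ⟨hmem' ε ⟨by linarith [hε.1], by linarith [hε.2]⟩ t ht, mem_univ _, ht⟩
  have hXc : ContinuousOn (fun z : ℝ × ℝ => X z.1 z.2) (Icc (-δ) δ ×ˢ Icc 0 1) := by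
    have e1 : ContinuousOn (fun z : ℝ × ℝ => u z.2) (Icc (-δ) δ ×ˢ Icc 0 1) :=
      hu.comp continuousOn_snd fun z hz => hz.2
    have e2 : ContinuousOn (fun z : ℝ × ℝ => v z.2) (Icc (-δ) δ ×ˢ Icc 0 1) :=
      hv.comp continuousOn_snd fun z hz => hz.2
    refine ContinuousOn.prodMk (e1.add (by fun_prop))
      (ContinuousOn.prodMk (e2.add (by fun_prop)) continuousOn_snd)
  set G : ℝ → ℝ → ℝ := fun ε t => fderivWithin ℝ ℓ T (X ε t) (φ t • h, ψ t • h, 0) with hG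
  have hGc : ContinuousOn (fun z : ℝ × ℝ => G z.1 z.2) (Icc (-δ) δ ×ˢ Icc 0 1) := by
    refine ((hℓ.continuousOn_fderivWithin hTu le_rfl).comp hXc fun z hz =>
      hXT z.1 hz.1 z.2 hz.2).clm_apply (Continuous.continuousOn ?_)
    fun_prop
  have hslice : ∀ {f : ℝ → ℝ → ℝ},
      ContinuousOn (fun z : ℝ × ℝ => f z.1 z.2) (Icc (-δ) δ ×ˢ Icc 0 1) →
      ∀ ε ∈ Icc (-δ) δ, ContinuousOn (f ε) (Icc 0 1) := fun hf ε hε =>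
    hf.comp (f := fun t => (ε, t)) (by fun_prop) fun t ht => ⟨hε, ht⟩
  have hFc : ContinuousOn (fun z : ℝ × ℝ => ℓ (X z.1 z.2)) (Icc (-δ) δ ×ˢ Icc 0 1) :=
    hℓ.continuousOn.comp hXc fun z hz => hXT z.1 hz.1 z.2 hz.2
  obtain ⟨B, hB⟩ := (isCompact_Icc.prod isCompact_Icc).exists_bound_of_continuousOn hGc
  have h0 : (0 : ℝ) ∈ Icc (-δ) δ := ⟨by linarith, hδ.le⟩
  have hsub : uIoc (0 : ℝ) 1 ⊆ Icc 0 1 := by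
    rw [uIoc_of_le zero_le_one]
    exact Ioc_subset_Icc_self
  have hmeas : ∀ {f : ℝ → ℝ}, ContinuousOn f (Icc 0 1) →
      AEStronglyMeasurable f (volume.restrict (uIoc (0 : ℝ) 1)) := fun hf =>
    (hf.mono hsub).aestronglyMeasurable measurableSet_uIoc
  have key := (intervalIntegral.hasDerivAt_integral_of_dominated_loc_of_deriv_le
    (F := fun ε t => ℓ (X ε t)) (F' := G) (x₀ := 0) (s := Ioo (-δ) δ) (a := 0) (b := 1)
    (bound := fun _ => B) (μ := volume) (Ioo_mem_nhds (by linarith) hδ) ?_ ?_ ?_ ?_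
    intervalIntegrable_const ?_).2
  · simpa [hG, hX] using key
  · filter_upwards [Ioo_mem_nhds (show -δ < 0 by linarith) hδ] with ε hε
    exact hmeas (hslice (f := fun ε t => ℓ (X ε t)) hFc ε (Ioo_subset_Icc_self hε))
  · refine ContinuousOn.intervalIntegrable ?_
    rw [uIcc_of_le zero_le_one]
    exact hslice (f := fun ε t => ℓ (X ε t)) hFc 0 h0
  · exact hmeas (hslice hGc 0 h0)
  · exact Eventually.of_forall fun t ht ε hε =>
      hB (ε, t) ⟨Ioo_subset_Icc_self hε, hsub ht⟩
  · refine Eventually.of_forall fun t ht ε hε => ?_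
    have h1 : HasFDerivWithinAt ℓ (fderivWithin ℝ ℓ T (X ε t)) T (X ε t) :=
      (hℓ.differentiableOn one_ne_zero _ (hXT ε (Ioo_subset_Icc_self hε) t
        (hsub ht))).hasFDerivWithinAt
    have hlin : ∀ (w : E) (c : ℝ), HasDerivAt (fun ε : ℝ => w + (ε * c) • h) (c • h) ε :=
      fun w c => by
        simpa using (((hasDerivAt_id ε).mul_const c).smul_const h).const_add w
    have h2 : HasDerivAt (fun ε => X ε t) (φ t • h, ψ t • h, 0) ε :=
      (hlin _ _).prodMk ((hlin _ _).prodMk (hasDerivAt_const ε t))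
    refine h1.comp_hasDerivAt ε h2 ?_
    filter_upwards [isOpen_Ioo.mem_nhds hε] with ε' hε'
    exact hXT ε' (Ioo_subset_Icc_self hε') t (hsub ht)

end CalculusOfVariations

variable {Ω : Type*} [MeasurableSpace Ω] {μ : Measure Ω} [IsProbabilityMeasure μ]

/-! ### Changes of charts -/

theorem logRatio_ae (p q : MaxExp μ) :
    (logRatio p q).1 =ᵐ[μ] fun x => Real.log (q.1.1 x / p.1.1 x) :=
  AEEqFun.coeFn_mk _ _

theorem eq_logRatio {p q : MaxExp μ} {h : ExpSpace μ}
    (hh : h.1 =ᵐ[μ] fun x => Real.log (q.1.1 x / p.1.1 x)) : h = logRatio p q :=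
  Subtype.ext (AEEqFun.ext (hh.trans (logRatio_ae p q).symm))

theorem logRatio_add (p q r : MaxExp μ) : logRatio p q + logRatio q r = logRatio p r := by
  apply eq_logRatio
  filter_upwards [coe_add_ae (logRatio p q) (logRatio q r), logRatio_ae p q, logRatio_ae q r,
    p.1.2.1, q.1.2.1, r.1.2.1] with x h1 h2 h3 h4 h5 h6
  rw [h1, h2, h3, Real.log_div h5.ne' h4.ne', Real.log_div h6.ne' h5.ne',
    Real.log_div h6.ne' h4.ne']
  ring

/-- Changes of exponential charts are affine, with the exponential transport as linear part. -/
theorem chart_eq_eTransport_add (p r q : MaxExp μ) :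
    chart r q = eTransport p r (chart p q) + chart r p := by
  change centering r (logRatio r q) =
    centering r (centering p (logRatio p q)).1 + centering r (logRatio r p)
  rw [centering_coe, map_sub, map_smul, centering_oneVec, smul_zero, sub_zero, ← map_add,
    add_comm, logRatio_add]

theorem eq_exp_chart_mul (p q : MaxExp μ) : q.1.1 =ᵐ[μ] fun x =>
    Real.exp ((chart p q).1.1 x - -expect p (logRatio p q)) * p.1.1 x := by
  filter_upwards [centering_ae p (logRatio p q), logRatio_ae p q, p.1.2.1, q.1.2.1]
    with x h1 h2 h3 h4
  have h5 : (chart p q).1.1 x = _ := h1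
  rw [h5, h2, sub_neg_eq_add, sub_add_cancel, Real.exp_log (div_pos h4 h3),
    div_mul_cancel₀ _ h3.ne']

theorem logRatio_expMap {p : MaxExp μ} {u : ExpFiber p.1} (hu : u ∈ chartDomain p.1) :
    u.1 - cumulant p.1 u • oneVec μ = logRatio p (expMap p u) := by
  apply eq_logRatio
  rw [expMap, dif_pos hu]
  filter_upwards [coe_sub_smul_oneVec u.1 (cumulant p.1 u),
    expDensity_ae p.1 u (interior_subset hu), p.1.2.1] with x h1 h2 h3
  rw [h1, h2, mul_div_cancel_right₀ _ h3.ne', Real.log_exp]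

theorem chart_expMap {p : MaxExp μ} {u : ExpFiber p.1} (hu : u ∈ chartDomain p.1) :
    chart p (expMap p u) = u := by
  rw [chart, ← logRatio_expMap hu, map_sub, map_smul, centering_oneVec, smul_zero, sub_zero,
    centering_self]

/-- In the chart centred at `p`, a density with coordinate `v` at the reference density `1` has
as coordinate the centred sum of `v` and the coordinate of `1`. -/
theorem exists_chart_eq_centering_add (p q : MaxExp μ) :
    ∃ v, ∃ _ : v ∈ chartDomain (maxExpOne μ).1, expMap (maxExpOne μ) v = q ∧
      centering p (v.1 + (chart p (maxExpOne μ)).1) = chart p q := by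
  obtain ⟨v, hv, hq⟩ := (isMaxExp_iff q.1).1 q.2
  have hq' : expMap (maxExpOne μ) v = q := by
    rw [expMap, dif_pos hv]
    refine Subtype.ext (Subtype.ext (AEEqFun.ext ?_))
    filter_upwards [expDensity_ae _ v (interior_subset hv), hq, maxExpOne_ae] with x h1 h2 h3
    rw [h1, h2, h3, mul_one]
  refine ⟨v, hv, hq', ?_⟩
  rw [map_add, centering_self, chart_eq_eTransport_add (maxExpOne μ) p q, ← hq', chart_expMap hv]
  rfl

theorem chart_mem_chartDomain (p q : MaxExp μ) : chart p q ∈ chartDomain p.1 := by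
  obtain ⟨v, hv, -, h⟩ := exists_chart_eq_centering_add p q
  rw [← h]
  exact centering_add_mem p (maxExpOne μ) _ _ (eq_exp_chart_mul p _) v hv

theorem expMap_chart (p q : MaxExp μ) : expMap p (chart p q) = q := by
  obtain ⟨v, hv, hq, h⟩ := exists_chart_eq_centering_add p q
  have h1 := expDensity_center_add p (maxExpOne μ) _ _ (eq_exp_chart_mul p _) v hv
  have h2 : (expDensity (maxExpOne μ).1 v (interior_subset hv)).1 = q.1.1 := by
    rw [← hq, expMap, dif_pos hv]
  rw [h, h2] at h1
  rw [expMap, dif_pos (chart_mem_chartDomain p q)]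
  refine Subtype.ext (Subtype.ext (AEEqFun.ext ?_))
  exact (expDensity_ae p.1 (chart p q) (interior_subset (chart_mem_chartDomain p q))).trans h1.symm

theorem chart_self (p : MaxExp μ) : chart p p = 0 := by
  have h : logRatio p p = 0 := by simpa using logRatio_add p p p
  rw [chart, h, map_zero]

theorem isOpen_chartDomain (p : PosDensity μ) : IsOpen (chartDomain p) := isOpen_interior

/-- The velocity of a curve is the transport of the derivative of its expression in any chart. -/
theorem velocity_eq {I : Set ℝ} {γ : ℝ → MaxExp μ} {t : ℝ} (hI : UniqueDiffWithinAt ℝ I t)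
    (p : MaxExp μ) {d : ExpFiber p.1} (h : HasDerivWithinAt (fun s => chart p (γ s)) d I t) :
    velocity I γ t = eTransport p (γ t) d := by
  have h1 : HasDerivWithinAt (fun s => chart (γ t) (γ s)) (eTransport p (γ t) d) I t := by
    simp_rw [fun s => chart_eq_eTransport_add p (γ t) (γ s)]
    exact ((eTransport p (γ t)).hasFDerivAt.comp_hasDerivWithinAt t h).add_const _
  exact h1.derivWithin hI

/-- A map into the model given in one chart by a smooth map is smooth. -/
theorem smoothOn_expMap {E : Type*} [NormedAddCommGroup E] [NormedSpace ℝ E] (p : MaxExp μ)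
    {f : E → ExpFiber p.1} {s : Set E} (hf : ContDiffOn ℝ ∞ f s)
    (hs : ∀ x ∈ s, f x ∈ chartDomain p.1) : SmoothOn (fun x => expMap p (f x)) s := by
  intro r
  refine ContDiffOn.congr (f := fun x => eTransport p r (f x) + chart r p)
    (((eTransport p r).contDiff.comp_contDiffOn hf).add contDiffOn_const) fun x hx => ?_
  rw [chart_eq_eTransport_add p r, chart_expMap (hs x hx)]

/-! ### Mixture transports and the duality pairing -/

theorem mTransport_ae (p q : MaxExp μ) (v : MixFiber p.1) :
    (mTransport p q v).1.1 =ᵐ[μ] fun x => p.1.1 x / q.1.1 x * v.1.1 x :=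
  AEEqFun.coeFn_mk _ _

theorem mTransport_mTransport (p q : MaxExp μ) (v : MixFiber p.1) :
    mTransport q p (mTransport p q v) = v := by
  refine Fiber.ext (Subtype.ext (AEEqFun.ext ?_))
  filter_upwards [mTransport_ae q p (mTransport p q v), mTransport_ae p q v, p.1.2.1, q.1.2.1]
    with x h1 h2 h3 h4
  rw [h1, h2]
  field_simp

/-- `exp (l |h|)` is integrable against every density of the model for small `l > 0`. -/
theorem exists_integrable_exp_abs (p : MaxExp μ) (h : ExpSpace μ) :
    ∃ l : ℝ, 0 < l ∧ Integrable (fun x => Real.exp (l * |h.1 x|)) p.1.toMeasure := by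
  have h0 : (0 : ExpFiber p.1) ∈ chartDomain p.1 := chart_self p ▸ chart_mem_chartDomain p p
  obtain ⟨a, ha, -, hia⟩ := exists_add_smul_mem h0 (centering p h)
  obtain ⟨b, hb, -, hib⟩ := exists_add_smul_mem h0 (-centering p h)
  rw [zero_add, mem_properDomain_iff] at hia hib
  refine ⟨min a b, lt_min ha hb,
    ((hia.add hib).const_mul (Real.exp (min a b * |expect p h|))).mono' ?_ ?_⟩
  · exact (Real.continuous_exp.measurable.comp
      (h.1.measurable.abs.const_mul _)).aestronglyMeasurable
  · refine p.1.toMeasure_ac.ae_le ?_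
    filter_upwards [coe_smul_ae a (centering p h).1, coe_smul_ae b (-centering p h).1,
      AEEqFun.coeFn_neg (centering p h).1.1, centering_ae p h] with x h1 h2 h3 h4
    have h5 : (a • centering p h).1.1 x = a * (h.1 x - expect p h) := by
      rw [← h4]
      exact h1
    have h6 : (b • -centering p h).1.1 x = b * -(h.1 x - expect p h) := by
      rw [← h4]
      exact h2.trans (congrArg (b * ·) h3)
    rw [Pi.add_apply, h5, h6, Real.norm_eq_abs, abs_of_pos (Real.exp_pos _)]
    set c := expect p h
    have h7 : |h.1 x| ≤ |h.1 x - c| + |c| := by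
      simpa using abs_add_le (h.1 x - c) c
    have h8 : Real.exp (min a b * |h.1 x - c|) ≤
        Real.exp (a * (h.1 x - c)) + Real.exp (b * -(h.1 x - c)) := by
      rcases abs_cases (h.1 x - c) with ⟨e, e'⟩ | ⟨e, e'⟩ <;> rw [e]
      · have : Real.exp (min a b * (h.1 x - c)) ≤ Real.exp (a * (h.1 x - c)) :=
          Real.exp_le_exp.2 (mul_le_mul_of_nonneg_right (min_le_left _ _) e')
        linarith [Real.exp_pos (b * -(h.1 x - c))]
      · have : Real.exp (min a b * -(h.1 x - c)) ≤ Real.exp (b * -(h.1 x - c)) :=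
          Real.exp_le_exp.2 (mul_le_mul_of_nonneg_right (min_le_right _ _) (by linarith))
        linarith [Real.exp_pos (a * (h.1 x - c))]
    calc Real.exp (min a b * |h.1 x|) ≤ Real.exp (min a b * |c| + min a b * |h.1 x - c|) := by
          rw [← mul_add, add_comm]
          exact Real.exp_le_exp.2 (mul_le_mul_of_nonneg_left h7 (lt_min ha hb).le)
      _ = Real.exp (min a b * |c|) * Real.exp (min a b * |h.1 x - c|) := Real.exp_add _ _
      _ ≤ _ := mul_le_mul_of_nonneg_left h8 (Real.exp_pos _).le

theorem integrable_mul_of_mem (p : MaxExp μ) (η : OrliczSpace expTwoStar p.1) (h : ExpSpace μ) :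
    Integrable (fun x => η.1 x * h.1 x) p.1.toMeasure := by
  obtain ⟨l, hl, hi⟩ := exists_integrable_exp_abs p h
  obtain ⟨ρ, hρ, hm⟩ := η.2
  have hψ : Integrable (fun x => expTwoStar (ρ⁻¹ * η.1 x)) p.1.toMeasure := by
    refine ⟨(expTwoStar.continuous'.measurable.comp
      (η.1.measurable.const_mul _)).aestronglyMeasurable, ?_⟩
    rw [hasFiniteIntegral_iff_ofReal (Eventually.of_forall fun x => expTwoStar.nonneg _)]
    exact hm
  refine ((hi.add hψ).const_mul (ρ * l⁻¹)).mono'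
    (η.1.measurable.mul h.1.measurable).aestronglyMeasurable (Eventually.of_forall fun x => ?_)
  have h1 := young_exp (x := l * |h.1 x|) (abs_nonneg (ρ⁻¹ * η.1 x))
  rw [expTwoStar.map_abs, abs_mul, abs_of_pos (inv_pos.2 hρ)] at h1
  have h2 : 0 ≤ l * |h.1 x| := by positivity
  have h3 : |η.1 x| * |h.1 x| = ρ * l⁻¹ * (l * |h.1 x| * (ρ⁻¹ * |η.1 x|)) := by
    field_simp
  rw [Real.norm_eq_abs, abs_mul, h3, Pi.add_apply]
  gcongr
  linarith

theorem pairing_sub (p : MaxExp μ) (η ζ : MixFiber p.1) (h : ExpFiber p.1) :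
    pairing p.1 (η - ζ) h = pairing p.1 η h - pairing p.1 ζ h := by
  rw [pairing, pairing, pairing, ← integral_sub (integrable_mul_of_mem p _ _)
    (integrable_mul_of_mem p _ _)]
  refine integral_congr_ae (p.1.toMeasure_ac.ae_le ?_)
  filter_upwards [AEEqFun.coeFn_sub η.1.1 ζ.1.1] with x hx
  have : (η - ζ).1.1 x = η.1.1 x - ζ.1.1 x := hx
  rw [this, sub_mul]

theorem pairing_smul (p : MaxExp μ) (c : ℝ) (η : MixFiber p.1) (h : ExpFiber p.1) :
    pairing p.1 (c • η) h = c * pairing p.1 η h := by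
  rw [pairing, pairing, ← integral_const_mul]
  refine integral_congr_ae (p.1.toMeasure_ac.ae_le ?_)
  filter_upwards [AEEqFun.coeFn_smul c η.1.1] with x hx
  have : (c • η).1.1 x = c * η.1.1 x := hx
  rw [this, mul_assoc]

/-- A centred mixture vector does not see the constants. -/
theorem pairing_centering (p : MaxExp μ) (η : MixFiber p.1) (h : ExpSpace μ) :
    pairing p.1 η (centering p h) = ∫ x, η.1.1 x * h.1 x ∂p.1.toMeasure := by
  have h1 : pairing p.1 η (centering p h) =
      ∫ x, (η.1.1 x * h.1 x - η.1.1 x * expect p h) ∂p.1.toMeasure := by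
    refine integral_congr_ae (p.1.toMeasure_ac.ae_le ?_)
    filter_upwards [centering_ae p h] with x hx
    rw [hx, mul_sub]
  rw [h1, integral_sub (integrable_mul_of_mem p _ _) (η.2.1.mul_const _), integral_mul_const,
    η.2.2, zero_mul, sub_zero]

/-- The mixture and the exponential transport are dual to each other. -/
theorem pairing_eTransport (p q : MaxExp μ) (η : MixFiber q.1) (h : ExpFiber p.1) :
    pairing q.1 η (eTransport p q h) = pairing p.1 (mTransport q p η) h := by
  refine (pairing_centering q η h.1).trans ?_
  rw [pairing, integral_toMeasure, integral_toMeasure]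
  refine integral_congr_ae ?_
  filter_upwards [mTransport_ae q p η, p.1.2.1] with x h1 h2
  rw [h1]
  field_simp

/-! ### The mixture norm is controlled by the duality pairing -/

/-- A uniform exponential moment for `p · μ` bounds the norm of `L^{cosh - 1}(μ)`: the change of
measure costs only a power of `p`, and some negative power of `p` is `μ`-integrable. -/
theorem exists_norm_le_of_lintegral_exp_abs (p : MaxExp μ) :
    ∃ C : ℝ, 0 < C ∧ ∀ h : ExpSpace μ,
      ∫⁻ x, ENNReal.ofReal (Real.exp |h.1 x|) ∂p.1.toMeasure ≤ 2 → ‖h‖ ≤ C := by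
  obtain ⟨l, hl, -, hJ⟩ := exists_integrable_ratio_rpow (maxExpOne μ) p
  have hJ' : ∫⁻ x, ENNReal.ofReal ((p.1.1 x)⁻¹ ^ l) ∂μ < ⊤ := by
    refine lt_of_eq_of_lt (lintegral_congr_ae ?_) hJ
    filter_upwards [maxExpOne_ae (μ := μ)] with x hx
    rw [hx, one_mul, one_div]
  set J : ℝ≥0∞ := ∫⁻ x, ENNReal.ofReal ((p.1.1 x)⁻¹ ^ l) ∂μ
  set s : ℝ := l / (1 + l) with hs
  have hs0 : 0 < s := by positivity
  set M : ℝ := 2 + J.toReal with hM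
  have hM1 : 1 ≤ M := by linarith [ENNReal.toReal_nonneg (a := J)]
  have hM0 : 0 < M := by linarith
  refine ⟨M / s, by positivity, fun h hh => norm_le_of_modular_le (by positivity) ?_⟩
  have hexp : ∫⁻ x, ENNReal.ofReal (Real.exp (s * |h.1 x|)) ∂μ ≤ ENNReal.ofReal M := by
    rw [p.1.lintegral_toMeasure (by
      exact (Real.continuous_exp.measurable.comp h.1.measurable.abs).ennreal_ofReal)] at hh
    calc ∫⁻ x, ENNReal.ofReal (Real.exp (s * |h.1 x|)) ∂μ
        ≤ ∫⁻ x, (ENNReal.ofReal (p.1.1 x) * ENNReal.ofReal (Real.exp |h.1 x|) +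
            ENNReal.ofReal ((p.1.1 x)⁻¹ ^ l)) ∂μ := by
          refine lintegral_mono_ae ?_
          filter_upwards [p.1.2.1] with x hx
          rw [← ENNReal.ofReal_mul hx.le, ← ENNReal.ofReal_add (by positivity) (by positivity)]
          refine ENNReal.ofReal_le_ofReal ?_
          set y := Real.log (p.1.1 x) with hy
          have e1 : p.1.1 x * Real.exp |h.1 x| = Real.exp (|h.1 x| + y) := by
            rw [Real.exp_add, hy, Real.exp_log hx, mul_comm]
          have e2 : (p.1.1 x)⁻¹ ^ l = Real.exp (-(l * y)) := by
            rw [Real.rpow_def_of_pos (inv_pos.2 hx), Real.log_inv, hy]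
            ring_nf
          -- `s` is the weight for which the two occurrences of `log p` cancel
          have e3 := convexOn_exp.2 (mem_univ (|h.1 x| + y)) (mem_univ (-(l * y)))
            hs0.le (show 0 ≤ 1 / (1 + l) by positivity) (by rw [hs]; field_simp; ring)
          have e4 : s * (|h.1 x| + y) + 1 / (1 + l) * (-(l * y)) = s * |h.1 x| := by
            rw [hs]
            field_simp
            ring
          simp only [smul_eq_mul] at e3
          rw [e4] at e3
          rw [e1, e2]
          have e5 : s ≤ 1 := by
            rw [hs, div_le_one (by positivity)]
            linarith
          have e6 : 1 / (1 + l) ≤ 1 := by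
            rw [div_le_one (by positivity)]
            linarith
          exact e3.trans (add_le_add (mul_le_of_le_one_left (Real.exp_pos _).le e5)
            (mul_le_of_le_one_left (Real.exp_pos _).le e6))
      _ = ∫⁻ x, ENNReal.ofReal (p.1.1 x) * ENNReal.ofReal (Real.exp |h.1 x|) ∂μ + J :=
          lintegral_add_left (p.1.measurable_ofReal.mul
            (Real.continuous_exp.measurable.comp h.1.measurable.abs).ennreal_ofReal) _
      _ ≤ 2 + J := by gcongr
      _ = ENNReal.ofReal M := by
          rw [hM, ENNReal.ofReal_add (by norm_num) ENNReal.toReal_nonneg,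
            ENNReal.ofReal_toReal hJ'.ne]
          simp
  have h1 := modular_mul_le (Φ := coshTwo) (p := (1 : PosDensity μ)) (f := fun x => s * h.1 x)
    (a := M⁻¹) (by positivity) (inv_le_one_of_one_le₀ hM1)
  have h2 : modular coshTwo (1 : PosDensity μ) (fun x => s * h.1 x) ≤ ENNReal.ofReal M := by
    refine le_trans ?_ hexp
    rw [modular, PosDensity.toMeasure_one]
    refine lintegral_mono fun x => ENNReal.ofReal_le_ofReal ?_
    change Real.cosh (s * h.1 x) - 1 ≤ _
    rw [← Real.cosh_abs, abs_mul, abs_of_pos hs0, Real.cosh_eq]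
    have : Real.exp (-(s * |h.1 x|)) ≤ 1 := Real.exp_le_one_iff.2 (by
      have : 0 ≤ s * |h.1 x| := by positivity
      linarith)
    linarith [Real.exp_pos (s * |h.1 x|)]
  have e : (fun x => (M / s)⁻¹ * h.1 x) = fun x => M⁻¹ * (s * h.1 x) := by
    ext x
    field_simp
  rw [e]
  calc _ ≤ ENNReal.ofReal M⁻¹ * ENNReal.ofReal M := h1.trans (by gcongr)
    _ = 1 := by
      rw [← ENNReal.ofReal_mul (by positivity), inv_mul_cancel₀ hM0.ne', ENNReal.ofReal_one]

/-- Bounded random variables belong to `L^{cosh - 1}(μ)`. -/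
theorem exists_expSpace_of_bounded {f : Ω → ℝ} (hf : Measurable f) {C : ℝ}
    (hC : ∀ x, |f x| ≤ C) : ∃ h : ExpSpace μ, h.1 =ᵐ[μ] f := by
  refine ⟨⟨AEEqFun.mk f hf.aestronglyMeasurable, 1, one_pos, ?_⟩, AEEqFun.coeFn_mk _ _⟩
  rw [modular_congr (g := f)]
  · refine (modular_mono (g := fun _ => C) fun x => (hC x).trans (le_abs_self C)).trans_lt ?_
    simp [modular]
  · filter_upwards [AEEqFun.coeFn_mk (μ := μ) f hf.aestronglyMeasurable] with x hx
    rw [hx, inv_one, one_mul]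

/-- A mixture vector with a small pairing against the unit ball of the exponential fibre lies in the
unit ball of the modular. The test functions are `sgn η · log (1 + |η|)`, with `η` cut off where
`|η| > n`: for them Young's inequality is an equality, and they are bounded, hence admissible. -/
theorem exists_modular_le_one (p : MaxExp μ) : ∃ N : ℝ, 0 < N ∧ ∀ η : MixFiber p.1,
    (∀ h : ExpFiber p.1, |pairing p.1 η h| ≤ N * ‖h‖) →
      modular expTwoStar p.1 (fun x => η.1.1 x) ≤ 1 := by
  obtain ⟨C, hC, H⟩ := exists_norm_le_of_lintegral_exp_abs p
  set c := ‖centering p‖ + 1 with hc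
  have hc0 : 0 < c := by positivity
  refine ⟨(2 * (c * C))⁻¹, by positivity, fun η hη => ?_⟩
  set P := p.1.toMeasure
  have hηm : Measurable (fun x => η.1.1 x) := η.1.1.measurable
  set y : ℕ → Ω → ℝ := fun n x => if |η.1.1 x| ≤ n then |η.1.1 x| else 0 with hy
  have hy0 : ∀ n x, 0 ≤ y n x := fun n x => by
    simp only [hy]
    split_ifs <;> positivity
  have hyn : ∀ n x, y n x ≤ n := fun n x => by
    simp only [hy]
    split_ifs with h
    exacts [h, Nat.cast_nonneg n]
  have hym : ∀ n, Measurable (y n) := fun n =>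
    Measurable.ite (measurableSet_le hηm.abs measurable_const) hηm.abs measurable_const
  have hlogm : ∀ n, Measurable fun x => Real.log (1 + y n x) := fun n =>
    Real.measurable_log.comp ((hym n).const_add 1)
  have hlog0 : ∀ n x, 0 ≤ Real.log (1 + y n x) := fun n x =>
    Real.log_nonneg (by linarith [hy0 n x])
  have hlogn : ∀ n x, Real.log (1 + y n x) ≤ n := fun n x => by
    have := Real.log_le_sub_one_of_pos (x := 1 + y n x) (by linarith [hy0 n x])
    linarith [hyn n x]
  have hyi : ∀ n, Integrable (y n) P := fun n =>
    Integrable.of_bound (hym n).aestronglyMeasurable n (Eventually.of_forall fun x => by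
      rw [Real.norm_eq_abs, abs_of_nonneg (hy0 n x)]
      exact hyn n x)
  have key : ∀ n, ∫⁻ x, ENNReal.ofReal (expTwoStar (y n x)) ∂P ≤ 1 := by
    intro n
    set m : ℝ := ∫ x, y n x ∂P with hm
    have hm0 : 0 ≤ m := integral_nonneg (hy0 n)
    -- dividing the test function by `M` brings its exponential moment below `2`
    set M : ℝ := 1 + m with hM
    have hM0 : 0 < M := by positivity
    set g : Ω → ℝ := fun x => SignType.sign (η.1.1 x) * Real.log (1 + y n x) with hg
    have hgm : Measurable g := by
      refine Measurable.mul ?_ (hlogm n)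
      have : (fun x => ((SignType.sign (η.1.1 x) : SignType) : ℝ)) = fun x =>
          if 0 < η.1.1 x then 1 else if η.1.1 x < 0 then -1 else 0 := by
        ext x
        rw [sign_apply]
        split_ifs <;> simp
      rw [this]
      exact Measurable.ite (measurableSet_lt measurable_const hηm) measurable_const
        (Measurable.ite (measurableSet_lt hηm measurable_const) measurable_const measurable_const)
    have hgle : ∀ x, |g x| ≤ Real.log (1 + y n x) := fun x => by
      rw [hg, abs_mul, abs_of_nonneg (hlog0 n x)]
      refine mul_le_of_le_one_left (hlog0 n x) ?_
      rcases SignType.sign (η.1.1 x) with _ | _ | _ <;> simp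
    have hηg : ∀ x, η.1.1 x * g x = y n x * Real.log (1 + y n x) := fun x => by
      simp only [hg, hy]
      split_ifs with h
      · rw [← mul_assoc, self_mul_sign]
      · simp
    obtain ⟨h, hh⟩ := exists_expSpace_of_bounded (μ := μ) (f := fun x => M⁻¹ * g x)
      (hgm.const_mul _) (C := M⁻¹ * n) fun x => by
        rw [abs_mul, abs_of_pos (inv_pos.2 hM0)]
        have := (hgle x).trans (hlogn n x)
        gcongr
    have hnorm : ‖h‖ ≤ C := by
      refine H h ?_
      calc ∫⁻ x, ENNReal.ofReal (Real.exp |h.1 x|) ∂P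
          ≤ ∫⁻ x, ENNReal.ofReal (1 + M⁻¹ * y n x) ∂P := by
            refine lintegral_mono_ae (p.1.toMeasure_ac.ae_le ?_)
            filter_upwards [hh] with x hx
            refine ENNReal.ofReal_le_ofReal ?_
            rw [hx, abs_mul, abs_of_pos (inv_pos.2 hM0)]
            have e1 := convexOn_exp.2 (mem_univ (Real.log (1 + y n x))) (mem_univ 0)
              (inv_pos.2 hM0).le (sub_nonneg.2 (inv_le_one_of_one_le₀ (show 1 ≤ M by linarith)))
              (by ring)
            simp only [smul_eq_mul, mul_zero, add_zero, Real.exp_zero, mul_one] at e1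
            rw [Real.exp_log (by linarith [hy0 n x])] at e1
            calc Real.exp (M⁻¹ * |g x|) ≤ Real.exp (M⁻¹ * Real.log (1 + y n x)) := by
                  have := hgle x
                  gcongr
              _ ≤ _ := e1
              _ = _ := by ring
        _ = ENNReal.ofReal (1 + M⁻¹ * m) := by
            have e2 : Integrable (fun x => 1 + M⁻¹ * y n x) P :=
              (integrable_const 1).add ((hyi n).const_mul _)
            rw [← ofReal_integral_eq_lintegral_ofReal e2
              (Eventually.of_forall fun x => by
                have := hy0 n x
                simp only [Pi.zero_apply]
                positivity), integral_add (integrable_const 1) ((hyi n).const_mul _),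
              integral_const_mul]
            simp [hm]
        _ ≤ 2 := by
            rw [← ENNReal.ofReal_ofNat 2]
            refine ENNReal.ofReal_le_ofReal ?_
            have : M⁻¹ * m ≤ 1 := by
              rw [inv_mul_le_iff₀ hM0]
              linarith
            linarith
    have hint : ∫ x, y n x * Real.log (1 + y n x) ∂P = M * pairing p.1 η (centering p h) := by
      rw [pairing_centering, ← integral_const_mul]
      refine integral_congr_ae (p.1.toMeasure_ac.ae_le ?_)
      filter_upwards [hh] with x hx
      rw [hx, ← hηg]
      field_simp
    have hle : ∫ x, y n x * Real.log (1 + y n x) ∂P ≤ M / 2 := by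
      have e1 : ‖centering p h‖ ≤ c * C := by
        refine ((centering p).le_opNorm h).trans ?_
        rw [hc]
        gcongr
        linarith
      have e2 : pairing p.1 η (centering p h) ≤ 2⁻¹ := by
        refine (le_abs_self _).trans ((hη _).trans ?_)
        calc (2 * (c * C))⁻¹ * ‖centering p h‖ ≤ (2 * (c * C))⁻¹ * (c * C) := by gcongr
          _ = 2⁻¹ := by field_simp
      rw [hint]
      nlinarith
    have hyl : Integrable (fun x => y n x * Real.log (1 + y n x)) P := by
      refine Integrable.of_bound ((hym n).mul (hlogm n)).aestronglyMeasurable (n * n)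
        (Eventually.of_forall fun x => ?_)
      rw [Real.norm_eq_abs, abs_of_nonneg (mul_nonneg (hy0 n x) (hlog0 n x))]
      exact mul_le_mul (hyn n x) (hlogn n x) (hlog0 n x) (Nat.cast_nonneg n)
    have hsub : Integrable (fun x => y n x * Real.log (1 + y n x) - y n x / 2) P :=
      hyl.sub ((hyi n).div_const 2)
    have hfin : Integrable (fun x => y n x * Real.log (1 + y n x) - y n x / 2 + 1 / 2) P :=
      hsub.add (integrable_const _)
    -- the tangent to `log` at `2`: `log (1 + y) ≤ y / 2 + log 2 - 1 / 2 ≤ y / 2 + 1 / 2`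
    have hpt : ∀ x, expTwoStar (y n x) ≤ y n x * Real.log (1 + y n x) - y n x / 2 + 1 / 2 := by
      intro x
      have e1 := Real.log_le_sub_one_of_pos (x := (1 + y n x) / 2) (by linarith [hy0 n x])
      rw [Real.log_div (by linarith [hy0 n x]) (by norm_num)] at e1
      simp only [expTwoStar, abs_of_nonneg (hy0 n x)]
      linarith [Real.log_two_lt_d9]
    calc ∫⁻ x, ENNReal.ofReal (expTwoStar (y n x)) ∂P
        ≤ ∫⁻ x, ENNReal.ofReal (y n x * Real.log (1 + y n x) - y n x / 2 + 1 / 2) ∂P :=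
          lintegral_mono fun x => ENNReal.ofReal_le_ofReal (hpt x)
      _ = ENNReal.ofReal (∫ x, (y n x * Real.log (1 + y n x) - y n x / 2 + 1 / 2) ∂P) :=
          (ofReal_integral_eq_lintegral_ofReal hfin
            (Eventually.of_forall fun x => (expTwoStar.nonneg _).trans (hpt x))).symm
      _ ≤ 1 := by
          rw [← ENNReal.ofReal_one]
          refine ENNReal.ofReal_le_ofReal ?_
          rw [integral_add hsub (integrable_const _),
            integral_sub hyl ((hyi n).div_const 2), integral_div]
          simp only [integral_const, probReal_univ, smul_eq_mul]
          linarith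
  have hlim : Tendsto (fun n => ∫⁻ x, ENNReal.ofReal (expTwoStar (y n x)) ∂P) atTop
      (𝓝 (∫⁻ x, ENNReal.ofReal (expTwoStar (η.1.1 x)) ∂P)) := by
    refine lintegral_tendsto_of_tendsto_of_monotone (fun n =>
      (expTwoStar.continuous'.measurable.comp (hym n)).ennreal_ofReal.aemeasurable)
      (Eventually.of_forall fun x => ?_) (Eventually.of_forall fun x => ?_)
    · intro i j hij
      have hij' : (i : ℝ) ≤ j := Nat.cast_le.2 hij
      simp only [hy]
      split_ifs with h1 h2 h2
      · exact le_rfl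
      · exact absurd (h1.trans hij') h2
      · rw [expTwoStar.map_zero', ENNReal.ofReal_zero]
        exact zero_le
      · exact le_rfl
    · obtain ⟨k, hk⟩ := exists_nat_ge |η.1.1 x|
      refine tendsto_const_nhds.congr' ?_
      filter_upwards [eventually_ge_atTop k] with n hn
      simp only [hy]
      rw [if_pos (hk.trans (Nat.cast_le.2 hn)), expTwoStar.map_abs]
  exact le_of_tendsto' hlim key

/-- The mixture fibre embeds topologically in the dual of the exponential fibre. -/
theorem exists_norm_le_of_pairing_le (p : MaxExp μ) : ∃ C : ℝ, 0 < C ∧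
    ∀ (η : MixFiber p.1) (N : ℝ), 0 ≤ N →
      (∀ h : ExpFiber p.1, |pairing p.1 η h| ≤ N * ‖h‖) → ‖η‖ ≤ C * N := by
  obtain ⟨N₀, hN₀, H⟩ := exists_modular_le_one p
  have key : ∀ (η : MixFiber p.1) (N : ℝ), 0 < N →
      (∀ h : ExpFiber p.1, |pairing p.1 η h| ≤ N * ‖h‖) → ‖η‖ ≤ N₀⁻¹ * N := by
    intro η N hN hη
    have h1 := H ((N₀ / N) • η) fun h => by
      rw [pairing_smul, abs_mul, abs_of_pos (by positivity)]
      calc N₀ / N * |pairing p.1 η h| ≤ N₀ / N * (N * ‖h‖) := by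
            have := hη h
            gcongr
        _ = N₀ * ‖h‖ := by field_simp
    refine norm_le_of_modular_le (f := η.1) (by positivity) (le_of_eq_of_le (modular_congr ?_) h1)
    filter_upwards [AEEqFun.coeFn_smul (N₀ / N) η.1.1] with x hx
    have : ((N₀ / N) • η).1.1 x = N₀ / N * η.1.1 x := hx
    rw [this]
    field_simp
  refine ⟨N₀⁻¹, by positivity, fun η N hN hη => le_of_forall_pos_le_add fun ε hε => ?_⟩
  have := key η (N + N₀ * ε) (by positivity) fun h => (hη h).trans (by
    have : 0 < N₀ * ε := by positivity
    gcongr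
    linarith)
  rwa [mul_add, inv_mul_cancel_left₀ hN₀.ne'] at this

/-! ### The Lagrangian in a chart -/

namespace Lagrangian

variable {L : Lagrangian μ}

/-- The domain of the expression of a Lagrangian in the chart centred at `p`. -/
abbrev chartSet (p : MaxExp μ) : Set (ExpFiber p.1 × ExpFiber p.1 × ℝ) :=
  chartDomain p.1 ×ˢ univ ×ˢ Icc (0 : ℝ) 1

theorem uniqueDiffOn_chartSet (p : MaxExp μ) : UniqueDiffOn ℝ (chartSet p) :=
  (isOpen_chartDomain p.1).uniqueDiffOn.prod
    (uniqueDiffOn_univ.prod (uniqueDiffOn_Icc zero_lt_one))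

theorem IsC1.hasDerivAt_inChart (hL : L.IsC1) {p : MaxExp μ}
    {c : ℝ → ExpFiber p.1 × ExpFiber p.1 × ℝ} {d : ExpFiber p.1 × ExpFiber p.1 × ℝ} {s : ℝ}
    (hc : HasDerivAt c d s) (hmem : ∀ᶠ r in 𝓝 s, c r ∈ chartSet p) :
    HasDerivAt (fun r => L.inChart p (c r))
      (fderivWithin ℝ (L.inChart p) (chartSet p) (c s) d) s :=
  ((hL p).differentiableOn one_ne_zero _ hmem.self_of_nhds).hasFDerivWithinAt.comp_hasDerivAt s
    hc hmem

/-- The derivative of `L` in the base direction is the pairing with the transport of `Grad L`. -/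
theorem HasGrad.fderivWithin_inChart {G : MixField μ} (hG : L.HasGrad G) (hL : L.IsC1)
    (p : MaxExp μ) {u : ExpFiber p.1} (hu : u ∈ chartDomain p.1) (v : ExpFiber p.1) {t : ℝ}
    (ht : t ∈ Icc (0 : ℝ) 1) (h : ExpFiber p.1) :
    fderivWithin ℝ (L.inChart p) (chartSet p) (u, v, t) (h, 0, 0) =
      pairing p.1 (mTransport (expMap p u) p
        (G (expMap p u) (eTransport p (expMap p u) v) t)) h := by
  -- the gradient is tested on the curve which is a straight line in the chart
  set c : ℝ → ExpFiber p.1 := fun s => u + s • h with hc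
  have hc0 : c 0 = u := by simp [hc]
  have hcd : HasDerivAt c h 0 := by
    simpa [hc] using ((hasDerivAt_id (0 : ℝ)).smul_const h).const_add u
  have hcc : ContDiff ℝ ∞ c := by fun_prop
  set I : Set ℝ := c ⁻¹' chartDomain p.1 with hI
  have hIo : IsOpen I := (isOpen_chartDomain p.1).preimage hcc.continuous
  have h0 : (0 : ℝ) ∈ I := by rwa [hI, mem_preimage, hc0]
  have hγ : SmoothOn (fun s => expMap p (c s)) I :=
    smoothOn_expMap p hcc.contDiffOn fun s hs => hs
  have h1 := hG p v t ht I _ hIo hγ 0 h0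
  have hvel : velocity I (fun s => expMap p (c s)) 0 = eTransport p (expMap p (c 0)) h := by
    refine velocity_eq (hIo.uniqueDiffWithinAt h0) p ?_
    exact hcd.hasDerivWithinAt.congr_of_mem (fun s hs => chart_expMap hs) h0
  rw [hvel, pairing_eTransport] at h1
  have h2 := hL.hasDerivAt_inChart (c := fun s => (c s, v, t)) (d := (h, 0, 0)) (s := 0)
    (hcd.prodMk (hasDerivAt_const _ _))
    (by
      filter_upwards [hIo.mem_nhds h0] with s hs
      exact ⟨hs, mem_univ _, ht⟩)
  have h3 := h2.unique h1
  rwa [hc0] at h3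

/-- The derivative of `L` in the fibre direction is the pairing with the transport of
`Grad_e L`. -/
theorem HasFiberGrad.fderivWithin_inChart {G : MixField μ} (hG : L.HasFiberGrad G) (hL : L.IsC1)
    (p : MaxExp μ) {u : ExpFiber p.1} (hu : u ∈ chartDomain p.1) (v : ExpFiber p.1) {t : ℝ}
    (ht : t ∈ Icc (0 : ℝ) 1) (h : ExpFiber p.1) :
    fderivWithin ℝ (L.inChart p) (chartSet p) (u, v, t) (0, h, 0) =
      pairing p.1 (mTransport (expMap p u) p
        (G (expMap p u) (eTransport p (expMap p u) v) t)) h := by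
  have h1 := hG (expMap p u) (eTransport p (expMap p u) v) (eTransport p (expMap p u) h) t ht
  simp_rw [← map_smul, ← map_add] at h1
  rw [pairing_eTransport] at h1
  have hcd : HasDerivAt (fun s : ℝ => v + s • h) h 0 := by
    simpa using ((hasDerivAt_id (0 : ℝ)).smul_const h).const_add v
  have h2 := hL.hasDerivAt_inChart (c := fun s => (u, v + s • h, t)) (d := (0, h, 0)) (s := 0)
    ((hasDerivAt_const _ _).prodMk (hcd.prodMk (hasDerivAt_const _ _)))
    (Eventually.of_forall fun s => ⟨hu, mem_univ _, ht⟩)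
  have h3 := h2.unique h1
  simpa using h3

/-- The action of a curve, computed in a chart. -/
theorem action_expMap (L : Lagrangian μ) (p : MaxExp μ) {u v : ℝ → ExpFiber p.1}
    (hu : ∀ t ∈ Icc (0 : ℝ) 1, u t ∈ chartDomain p.1)
    (hv : ∀ t ∈ Icc (0 : ℝ) 1, HasDerivWithinAt u (v t) (Icc 0 1) t) :
    L.action (fun t => expMap p (u t)) = ∫ t in (0 : ℝ)..1, L.inChart p (u t, v t, t) := by
  refine intervalIntegral.integral_congr fun t ht => ?_
  rw [uIcc_of_le zero_le_one] at ht
  have hvel : velocity (Icc 0 1) (fun t => expMap p (u t)) t =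
      eTransport p (expMap p (u t)) (v t) :=
    velocity_eq (uniqueDiffOn_Icc zero_lt_one t ht) p
      ((hv t ht).congr_of_mem (fun s hs => chart_expMap (hu s hs)) ht)
  simp only [inChart]
  rw [hvel]

end Lagrangian

/-! ### The Euler–Lagrange equation -/

/-- An extremal satisfies the weak Euler–Lagrange equation in every chart: variations which are
affine in the chart are smooth variations of the curve. -/
theorem Lagrangian.IsExtremal.integral_fderivWithin_eq_zero {L : Lagrangian μ} (hL : L.IsC1)
    {q : ℝ → MaxExp μ} (hq : SmoothOn q (Icc (0 : ℝ) 1)) (hext : L.IsExtremal q) (p : MaxExp μ)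
    (h : ExpFiber p.1) {φ : ℝ → ℝ} (hφ : ContDiff ℝ ∞ φ) (hφ0 : φ 0 = 0) (hφ1 : φ 1 = 0) :
    ∫ t in (0 : ℝ)..1, fderivWithin ℝ (L.inChart p) (Lagrangian.chartSet p)
      (chart p (q t), derivWithin (fun s => chart p (q s)) (Icc 0 1) t, t)
      (φ t • h, deriv φ t • h, 0) = 0 := by
  have hu : ContDiffOn ℝ ∞ (fun t => chart p (q t)) (Icc 0 1) := hq p
  set u : ℝ → ExpFiber p.1 := fun t => chart p (q t) with hu_def
  set v : ℝ → ExpFiber p.1 := derivWithin u (Icc 0 1) with hv_def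
  have hv : ContinuousOn v (Icc 0 1) :=
    hu.continuousOn_derivWithin (uniqueDiffOn_Icc zero_lt_one) (by simp)
  have huS : ∀ t ∈ Icc (0 : ℝ) 1, u t ∈ chartDomain p.1 := fun t _ => chart_mem_chartDomain p _
  have hφ' : Continuous (deriv φ) := hφ.continuous_deriv (by simp)
  obtain ⟨δ, hδ, hmem⟩ := exists_forall_add_smul_mem (isOpen_chartDomain p.1) hu.continuousOn huS
    hφ.continuous h
  have hvar : IsVariation q fun ε t => expMap p (u t + (ε * φ t) • h) := by
    refine ⟨fun t _ => ?_, fun ε => ?_, fun ε => ?_, δ, hδ, ?_⟩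
    · simp [hu_def, expMap_chart]
    · simp [hu_def, hφ0, expMap_chart]
    · simp [hu_def, hφ1, expMap_chart]
    · refine smoothOn_expMap p (f := fun x : ℝ × ℝ => u x.2 + (x.1 * φ x.2) • h) ?_
        fun x hx => hmem x.1 hx.1 x.2 hx.2
      refine ContDiffOn.add (hu.comp contDiffOn_snd fun x hx => hx.2) (ContDiff.contDiffOn ?_)
      fun_prop
  refine HasDerivAt.unique ?_ (hext _ hvar)
  refine (hasDerivAt_integral_variation (isOpen_chartDomain p.1) (hL p) hu.continuousOn hv huS
    hφ.continuous hφ' h).congr_of_eventuallyEq ?_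
  filter_upwards [Ioo_mem_nhds (show -δ < 0 by linarith) hδ] with ε hε
  refine L.action_expMap p (hmem ε hε) fun t ht => ?_
  refine (hu.differentiableOn (by simp) t ht).hasDerivWithinAt.add ?_
  have h1 : HasDerivAt φ (deriv φ t) t := (hφ.differentiable (by simp) t).hasDerivAt
  exact ((h1.const_mul ε).smul_const h).hasDerivWithinAt

end StatBundle

theorem mainTheorem3 {Ω : Type*} [MeasurableSpace Ω] (μ : Measure Ω) [IsProbabilityMeasure μ]
    (L : StatBundle.Lagrangian μ) (hL : L.IsC1)
    (gradL gradE : StatBundle.MixField μ)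
    (hgradL : L.HasGrad gradL) (hgradE : L.HasFiberGrad gradE)
    (q : ℝ → StatBundle.MaxExp μ) (hq : StatBundle.SmoothOn q (Icc (0 : ℝ) 1))
    (hext : L.IsExtremal q) :
    ∀ t ∈ Icc (0 : ℝ) 1,
      StatBundle.HasMixCovDerivWithinAt q
        (fun s => gradE (q s) (StatBundle.velocity (Icc 0 1) q s) s) (Icc 0 1) t
        (gradL (q t) (StatBundle.velocity (Icc 0 1) q t) t) := by
  open StatBundle in
  intro t ht p
  refine ⟨mTransport (q t) p (gradL (q t) (velocity (Icc 0 1) q t) t), ?_,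
    mTransport_mTransport _ _ _⟩
  have hu : ContDiffOn ℝ ∞ (fun t => chart p (q t)) (Icc 0 1) := hq p
  set u : ℝ → ExpFiber p.1 := fun t => chart p (q t) with hu_def
  set v : ℝ → ExpFiber p.1 := derivWithin u (Icc 0 1) with hv_def
  have hv : ContinuousOn v (Icc 0 1) :=
    hu.continuousOn_derivWithin (uniqueDiffOn_Icc zero_lt_one) (by simp)
  have huS : ∀ s, u s ∈ chartDomain p.1 := fun s => chart_mem_chartDomain p _
  have hvel : ∀ s ∈ Icc (0 : ℝ) 1, velocity (Icc 0 1) q s = eTransport p (q s) (v s) :=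
    fun s hs => velocity_eq (uniqueDiffOn_Icc zero_lt_one s hs) p
      (hu.differentiableOn (by simp) s hs).hasDerivWithinAt
  set D : ℝ → ExpFiber p.1 × ExpFiber p.1 × ℝ →L[ℝ] ℝ := fun s =>
    fderivWithin ℝ (L.inChart p) (Lagrangian.chartSet p) (u s, v s, s) with hD
  have hDc : ContinuousOn D (Icc 0 1) :=
    ((hL p).continuousOn_fderivWithin (Lagrangian.uniqueDiffOn_chartSet p) le_rfl).comp
      (hu.continuousOn.prodMk (hv.prodMk continuousOn_id)) fun s hs => ⟨huS s, mem_univ _, hs⟩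
  -- the partial derivatives of the Lagrangian in the base and in the fibre direction
  set a : ℝ → ExpFiber p.1 →L[ℝ] ℝ := fun s => (D s).comp (.inl ℝ _ _) with ha
  set b : ℝ → ExpFiber p.1 →L[ℝ] ℝ := fun s =>
    (D s).comp ((ContinuousLinearMap.inr ℝ _ _).comp (.inl ℝ _ _)) with hb
  have haG : ∀ s ∈ Icc (0 : ℝ) 1, ∀ h,
      a s h = pairing p.1 (mTransport (q s) p (gradL (q s) (velocity (Icc 0 1) q s) s)) h := by
    intro s hs h
    rw [hvel s hs]
    have h1 := hgradL.fderivWithin_inChart hL p (huS s) (v s) hs h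
    rwa [show expMap p (u s) = q s from expMap_chart p (q s)] at h1
  have hbG : ∀ s ∈ Icc (0 : ℝ) 1, ∀ h,
      b s h = pairing p.1 (mTransport (q s) p (gradE (q s) (velocity (Icc 0 1) q s) s)) h := by
    intro s hs h
    rw [hvel s hs]
    have h1 := hgradE.fderivWithin_inChart hL p (huS s) (v s) hs h
    rwa [show expMap p (u s) = q s from expMap_chart p (q s)] at h1
  have hab : HasDerivWithinAt b (a t) (Icc 0 1) t := by
    refine hasDerivWithinAt_of_forall_integral_eq_zero (hDc.clm_comp continuousOn_const)
      (hDc.clm_comp continuousOn_const) (fun h φ hφ hφ0 hφ1 => ?_) ht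
    refine Eq.trans (intervalIntegral.integral_congr fun s _ => ?_)
      (hext.integral_fderivWithin_eq_zero hL hq p h hφ hφ0 hφ1)
    have h1 : (φ s • h, deriv φ s • h, (0 : ℝ)) = φ s • (h, (0 : ExpFiber p.1), (0 : ℝ)) +
        deriv φ s • ((0 : ExpFiber p.1), h, (0 : ℝ)) := by simp
    rw [h1, map_add, map_smul, map_smul]
    rfl
  obtain ⟨C, hC, hCle⟩ := exists_norm_le_of_pairing_le p
  rw [hasDerivWithinAt_iff_isLittleO] at hab ⊢
  refine Asymptotics.IsBigO.trans_isLittleO (Asymptotics.IsBigO.of_bound C ?_) hab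
  filter_upwards [self_mem_nhdsWithin] with s hs
  refine hCle _ _ (norm_nonneg _) fun h => ?_
  rw [pairing_sub, pairing_sub, pairing_smul, ← hbG s hs, ← hbG t ht, ← haG t ht]
  exact (b s - b t - (s - t) • a t).le_opNorm h
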